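/- **Setting.** Let $d,N\ge 0$ be integers, $\mathbb R_+=[0,\infty)$, and let $f=(f^1,\dots,f^d)$ with $f^k\in C^1(\mathbb R^N,\mathbb R^N)$. An *entropy pair* is a pair $(\eta,q)$, $\eta:\mathbb R^N\to\mathbb R$ convex and differentiable, $q=(q^1,\dots,q^d)$ with $(q^k)'=\eta'\,(f^k)'$. Fix a class $E$ of entropy pairs (for instance all of them, or a single one). A *Young measure* $\nu$ on $D$ is a weak* measurable map $z\mapsto\nu_z$ from $D$ to the probability measures on $\mathbb R^N$, with $\langle\nu_z,g\rangle=\int g\,d\nu_z$; $\nu^n\rightharpoonup\nu$ weak* means $\int_D\phi\langle\nu^n_z,g\rangle dz\to\int_D\phi\langle\nu_z,g\rangle dz$ for all $\phi\in L^1(D)$, $g\in C_0(\mathbb R^N)$. Write $\mathcal E(\sigma)$ for the set of entropy measure-valued (EMV) solutions, relative to $E$, of $$\partial_t\langle\nu,\mathrm{id}\rangle+\nabla_x\cdot\langle\nu,f\rangle=0,\qquad \nu_{(x,0)}=\sigma_x ,$$ that is, Young measures $\nu$ on $\mathbb R^d\times\mathbb R_+$ such that $$\int_{\mathbb R_+}\!\int_{\mathbb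 R^d}\partial_t\phi\,\langle\nu,\mathrm{id}\rangle+\nabla_x\phi\cdot\langle\nu,f\rangle\,dx\,dt+\int_{\mathbb R^d}\phi(x,0)\langle\sigma_x,\mathrm{id}\rangle dx=0$$ for all $\phi\in C^1_c(\mathbb R^d\times\mathbb R_+)$, and $$\int_{\mathbb R_+}\!\int_{\mathbb R^d}\partial_t\phi\,\langle\nu,\eta\rangle+\nabla_x\phi\cdot\langle\nu,q\rangle\,dx\,dt+\int_{\mathbb R^d}\phi(x,0)\langle\sigma_x,\eta\rangle dx\ge0$$ for all $0\le\phi\in C^1_c(\mathbb R^d\times\mathbb R_+)$ and $(\eta,q)\in E$, all pairings being well defined a.e. and locally integrable. **Scheme.** For each $\Delta x>0$ take a uniform Cartesian mesh with cells $\mathcal C_i$, $i\in\mathbb Z^d$, of side lengths $\Delta x_k=c_k\Delta x$ ($c_k>0$ fixed), and the semi-discrete scheme, integrated exactly in time, $$\frac{d}{dt}u_i+\sum_{k=1}^d\frac{F^k_{i+e_k/2}-F^k_{i-e_k/2}}{\Delta x_k}=0,$$ where $F^k_{i+e_k/2}$ is a function of the values $u_j$, $j\in i+\{-p+1,\dots,p\}^d$,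 $p\ge1$, that is consistent and locally Lipschitz: for each compact $K\subset\mathbb R^N$ there is $C$, independent of $\Delta x$, with $|F^k_{i+e_k/2}-f^k(u_i)|\le C\sum_j|u_j-u_i|$ whenever these $u_j$ lie in $K$. Let $\mathcal S^{\Delta x}$ be its evolution operator, whose values are regarded as piecewise constant functions in $x$. **Approximations.** Let $u_0\in L^1\cap L^\infty(\mathbb R^d;\mathbb R^N)$, and let $X$ be a (jointly measurable) random field on a probability space $(\Omega,P)$ with $X(\omega)\in L^1\cap L^\infty(\mathbb R^d;\mathbb R^N)$ for every $\omega$ and $\|X\|_{L^1}\le1$ almost surely. Fix $\varepsilon_0>0$. For $0<\varepsilon\le\varepsilon_0$ and $\Delta x>0$ let $\sigma^\varepsilon$ be the law of $u_0^\varepsilon=u_0+\varepsilon X$, let $u_0^{\Delta x,\varepsilon}(\omega)$ be a discretization of $u_0^\varepsilon(\omega)$ on the mesh, $\sigma^{\Delta x,\varepsilon}$ its law, $u^{\Delta x,\varepsilon}(\omega)=\mathcal S^{\Delta x}u_0^{\Delta x,\varepsilon}(\omega)$ (a random field), and $\nu^{\Delta x,\varepsilon}$ the law of $u^{\Delta x,\varepsilon}$.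 Assume: * (uniform boundedness) $|u^{\Delta x,\varepsilon}|\le C$ with $C$ independent of $\omega$, $\Delta x>0$ and $\varepsilon\in(0,\varepsilon_0]$; and, for each fixed $\varepsilon\in(0,\varepsilon_0]$, * (weak BV) there is $1\le r<\infty$ such that, for all $\omega$ and $T>0$, $\displaystyle\lim_{\Delta x\to0}\int_0^T\sum_{i}\sum_k|u_{i+e_k}-u_i|^r\,\Delta x_1\cdots\Delta x_d\,dt=0$, where $u=u^{\Delta x,\varepsilon}(\omega)$; * (entropy consistency) for every $(\eta,q)\in E$ there are numerical entropy fluxes $Q^k$, consistent with $q^k$ and locally Lipschitz in the above sense, such that $\frac{d}{dt}\eta(u_i)+\sum_k(Q^k_{i+e_k/2}-Q^k_{i-e_k/2})/\Delta x_k\le0$ for all $i$, $\omega$, $\Delta x$ and a.e. $t>0$; * (consistency with the initial data) as $\Delta x\to0$, $\int\psi\langle\sigma^{\Delta x,\varepsilon}_x,\mathrm{id}\rangle dx\to\int\psi\langle\sigma^\varepsilon_x,\mathrm{id}\rangle dx$ for all $\psi\in C^1_c(\mathbb R^d)$, and for every $(\eta,q)\in E$ the pairing $\langle\sigma^\varepsilon,\eta\rangle$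 is well defined a.e. and locally integrable (i.e. $\langle\sigma^\varepsilon,|\eta|\rangle\in L^1_{loc}$), and $\limsup\int\psi\langle\sigma^{\Delta x,\varepsilon}_x,\eta\rangle dx\le\int\psi\langle\sigma^\varepsilon_x,\eta\rangle dx$ for all $0\le\psi\in C^1_c(\mathbb R^d)$. **Theorem.** There are sequences $\Delta x_n>0$ and $\varepsilon_n\in(0,\varepsilon_0]$ with $(\Delta x_n,\varepsilon_n)\to(0,0)$, and an EMV solution $\nu\in\mathcal E(\delta_{u_0})$ with atomic initial data $\delta_{u_0}$, such that $\nu^{\Delta x_n,\varepsilon_n}\rightharpoonup\nu$ weak*. -/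

import Mathlib

open MeasureTheory Filter Topology Set
open scoped ENNReal ZeroAtInfty

namespace EMV

/-- Physical space `ℝ^d` (only its topology and Lebesgue measure are used). -/
abbrev Space (d : ℕ) := Fin d → ℝ

/-- Lebesgue measure on space-time `ℝ^d × ℝ_+`, with `ℝ_+ = [0, ∞)`. Functions on `ℝ^d × ℝ_+` are
represented by functions on `ℝ^d × ℝ`, whose values at negative times are irrelevant. -/
noncomputable def spaceTime (d : ℕ) : Measure (Space d × ℝ) :=
  volume.restrict (univ ×ˢ Ici (0 : ℝ))

/-- Phase space `ℝ^N` with the Euclidean norm. -/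
abbrev Phase (N : ℕ) := EuclideanSpace ℝ (Fin N)

/-! ### Young measures -/

section Young

variable {D : Type*} {N : ℕ}

/-- `ν` is a Young measure from `D` to `ℝ^N`: a weak* measurable map into the probability
measures on `ℝ^N`. -/
def IsYoungMeasure [MeasurableSpace D] (ν : D → Measure (Phase N)) : Prop :=
  (∀ z, IsProbabilityMeasure (ν z)) ∧ ∀ g : C₀(Phase N, ℝ), Measurable fun z => ∫ ξ, g ξ ∂(ν z)

/-- Weak* convergence of a sequence of Young measures, with respect to the measure `μ` on `D`. -/
def WeakStarTendsto [MeasurableSpace D] (μ : Measure D) (νs : ℕ → D → Measure (Phase N))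
    (ν : D → Measure (Phase N)) : Prop :=
  ∀ (g : C₀(Phase N, ℝ)) (φ : D → ℝ), Integrable φ μ →
    Tendsto (fun n => ∫ z, φ z * ∫ ξ, g ξ ∂(νs n z) ∂μ) atTop
      (𝓝 (∫ z, φ z * ∫ ξ, g ξ ∂(ν z) ∂μ))

/-- The law of a random field `U : Ω × D → ℝ^N`: `ν_z(A) = P(U(·, z) ∈ A)`. -/
noncomputable def law {Ω : Type*} [MeasurableSpace Ω] (P : Measure Ω) (U : Ω → D → Phase N) :
    D → Measure (Phase N) :=
  fun z => P.map fun ω => U ω z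

/-- The atomic Young measure `δ_u`. -/
noncomputable def atomic (u : D → Phase N) : D → Measure (Phase N) :=
  fun z => Measure.dirac (u z)

/-- The pairing `⟨ν, g⟩` is a well-defined, locally integrable function on `D`. -/
def PairingLocallyIntegrable [MeasurableSpace D] [TopologicalSpace D] {V : Type*}
    [NormedAddCommGroup V] (μ : Measure D) (ν : D → Measure (Phase N)) (g : Phase N → V) : Prop :=
  (∀ᵐ z ∂μ, Integrable g (ν z)) ∧ LocallyIntegrable (fun z => ∫ ξ, ‖g ξ‖ ∂(ν z)) μ

end Young

/-! ### Entropy pairs and (entropy) measure-valued solutions -/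

/-- `∂_t φ`. -/
noncomputable def dt {d : ℕ} (φ : Space d × ℝ → ℝ) (z : Space d × ℝ) : ℝ :=
  fderiv ℝ φ z (0, 1)

/-- `∂_{x_k} φ`. -/
noncomputable def dx {d : ℕ} (k : Fin d) (φ : Space d × ℝ → ℝ) (z : Space d × ℝ) : ℝ :=
  fderiv ℝ φ z (Pi.single k 1, 0)

/-- Test functions in `C^1_c(ℝ^d × ℝ_+)`, given as restrictions to `t ≥ 0` of compactly supported
`C^1` functions on `ℝ^d × ℝ`; they need not vanish at `t = 0`. -/
def IsTest {d : ℕ} (φ : Space d × ℝ → ℝ) : Prop :=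
  ContDiff ℝ 1 φ ∧ HasCompactSupport φ

/-- Test functions in `C^1_c(ℝ^d)`. -/
def IsSpatialTest {d : ℕ} (ψ : Space d → ℝ) : Prop :=
  ContDiff ℝ 1 ψ ∧ HasCompactSupport ψ

section Solutions

variable {d N : ℕ}

/-- `(η, q)` is an entropy pair for the flux `f = (f^1, …, f^d)`: `η` is convex and
`(q^k)' = η' · (f^k)'` for every direction `k`. -/
structure IsEntropyPair (f : Fin d → Phase N → Phase N)
    (η : Phase N → ℝ) (q : Fin d → Phase N → ℝ) : Prop where
  convex : ConvexOn ℝ univ η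
  differentiable : Differentiable ℝ η
  compatible : ∀ k ξ, HasFDerivAt (q k) ((fderiv ℝ η ξ).comp (fderiv ℝ (f k) ξ)) ξ

/-- The set of all entropy pairs of the flux `f`. -/
def entropyPairs (f : Fin d → Phase N → Phase N) :
    Set ((Phase N → ℝ) × (Fin d → Phase N → ℝ)) :=
  {e | IsEntropyPair f e.1 e.2}

/-- `ν` is a measure-valued solution of `∂_t ⟨ν, id⟩ + ∇_x · ⟨ν, f⟩ = 0`, `ν_{(x,0)} = σ_x`. -/
structure IsMVSolution (f : Fin d → Phase N → Phase N) (σ : Space d → Measure (Phase N))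
    (ν : Space d × ℝ → Measure (Phase N)) : Prop where
  young : IsYoungMeasure ν
  integrable_id : PairingLocallyIntegrable (spaceTime d) ν (id : Phase N → Phase N)
  integrable_flux : ∀ k, PairingLocallyIntegrable (spaceTime d) ν (f k)
  integrable_init : PairingLocallyIntegrable volume σ (id : Phase N → Phase N)
  weak_form : ∀ φ : Space d × ℝ → ℝ, IsTest φ →
    (∫ z, (dt φ z • (∫ ξ, ξ ∂(ν z)) + ∑ k, dx k φ z • ∫ ξ, f k ξ ∂(ν z)) ∂(spaceTime d))
      + ∫ x : Space d, φ (x, 0) • ∫ ξ, ξ ∂(σ x) = 0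

/-- The entropy inequality `∂_t ⟨ν, η⟩ + ∇_x · ⟨ν, q⟩ ≤ 0` in the sense of distributions, with
initial data `σ`. -/
structure EntropyInequality (η : Phase N → ℝ) (q : Fin d → Phase N → ℝ)
    (σ : Space d → Measure (Phase N)) (ν : Space d × ℝ → Measure (Phase N)) : Prop where
  integrable_entropy : PairingLocallyIntegrable (spaceTime d) ν η
  integrable_flux : ∀ k, PairingLocallyIntegrable (spaceTime d) ν (q k)
  integrable_init : PairingLocallyIntegrable volume σ η
  weak_form : ∀ φ : Space d × ℝ → ℝ, IsTest φ → (∀ x t, 0 ≤ t → 0 ≤ φ (x, t)) →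
    0 ≤ (∫ z, (dt φ z * (∫ ξ, η ξ ∂(ν z)) + ∑ k, dx k φ z * ∫ ξ, q k ξ ∂(ν z)) ∂(spaceTime d))
      + ∫ x : Space d, φ (x, 0) * ∫ ξ, η ξ ∂(σ x)

/-- The set `𝓔(σ)` of entropy measure-valued solutions with initial data `σ`, relative to a class
`E` of entropy pairs; for `E = entropyPairs f` the inequality is imposed for all entropy pairs. -/
def emvSolutions (f : Fin d → Phase N → Phase N)
    (E : Set ((Phase N → ℝ) × (Fin d → Phase N → ℝ))) (σ : Space d → Measure (Phase N)) :
    Set (Space d × ℝ → Measure (Phase N)) :=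
  {ν | IsMVSolution f σ ν ∧ ∀ e ∈ E, EntropyInequality e.1 e.2 σ ν}

end Solutions

/-! ### Uniform Cartesian meshes and semi-discrete finite difference schemes -/

/-- Cell indices. -/
abbrev Grid (d : ℕ) := Fin d → ℤ

/-- A family of uniform Cartesian meshes, one for each mesh size `h`, with fixed mesh ratios: the
cells of the mesh of size `h` have side length `ratio k * h` in direction `k`, and the cell with
index `0` has lower corner `corner h`. -/
structure Mesh (d : ℕ) where
  ratio : Fin d → ℝ
  ratio_pos : ∀ k, 0 < ratio k
  corner : ℝ → Space d

/-- The side length of the cells in direction `k`. -/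
def Mesh.width {d : ℕ} (M : Mesh d) (h : ℝ) (k : Fin d) : ℝ := M.ratio k * h

/-- The index of the (half-open) cell that contains `x`. -/
noncomputable def Mesh.cell {d : ℕ} (M : Mesh d) (h : ℝ) (x : Space d) : Grid d :=
  fun k => ⌊(x k - M.corner h k) / M.width h k⌋

/-- The offsets `{-p+1, …, p}^d` of the cells on which a numerical flux depends. -/
noncomputable def stencil (d p : ℕ) : Finset (Grid d) :=
  Fintype.piFinset fun _ => Finset.Icc (1 - (p : ℤ)) (p : ℤ)

section Scheme

variable {d N p : ℕ}

/-- The values of the grid function `w` on the stencil around the cell `i`. -/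
def atCell (p : ℕ) (w : Grid d → Phase N) (i : Grid d) : stencil d p → Phase N :=
  fun m => w (i + m)

/-- The numerical flux functions `F h` (for mesh size `h`) are consistent with `g` and locally
Lipschitz continuous: `|F_{i+1/2} - g(u_i)| ≤ C ∑_j |u_j - u_i|` as long as the values `u_j` in the
stencil stay in a compact set `K`, with `C` depending on `K` only. -/
def ConsistentFlux {V : Type*} [NormedAddCommGroup V] (F : ℝ → (stencil d p → Phase N) → V)
    (g : Phase N → V) : Prop :=
  ∀ K : Set (Phase N), IsCompact K → ∃ C : ℝ, 0 < C ∧ ∀ h : ℝ, 0 < h →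
    ∀ w : Grid d → Phase N, (∀ m ∈ stencil d p, w m ∈ K) →
      ‖F h (atCell p w 0) - g (w 0)‖ ≤ C * ∑ m ∈ stencil d p, ‖w m - w 0‖

/-- `∑_k (F^k_{i + e_k/2} - F^k_{i - e_k/2}) / Δx_k` for the grid function `w`. -/
noncomputable def fluxDifference {V : Type*} [NormedAddCommGroup V] [NormedSpace ℝ V]
    (M : Mesh d) (h : ℝ) (F : Fin d → (stencil d p → Phase N) → V) (w : Grid d → Phase N)
    (i : Grid d) : V :=
  ∑ k, (M.width h k)⁻¹ • (F k (atCell p w i) - F k (atCell p w (i - Pi.single k 1)))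

/-- `u : [0, ∞) → (ℝ^N)^(ℤ^d)` is the solution of the semi-discrete scheme with numerical flux `F`,
mesh size `h` and grid data `u₀`, with exact integration in time. -/
structure IsSchemeSolution (M : Mesh d) (h : ℝ) (F : Fin d → (stencil d p → Phase N) → Phase N)
    (u₀ : Grid d → Phase N) (u : ℝ → Grid d → Phase N) : Prop where
  init : u 0 = u₀
  integrable : ∀ i s t, 0 ≤ s → s ≤ t →
    IntervalIntegrable (fun τ => fluxDifference M h F (u τ) i) volume s t
  evolution : ∀ i s t, 0 ≤ s → s ≤ t →
    u t i = u s i - ∫ τ in s..t, fluxDifference M h F (u τ) i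

/-- The piecewise constant function on space-time with cell values `u`. -/
noncomputable def onSpaceTime (M : Mesh d) (h : ℝ) (u : ℝ → Grid d → Phase N) :
    Space d × ℝ → Phase N :=
  fun z => u z.2 (M.cell h z.1)

/-- The piecewise constant function on space with cell values `w`. -/
noncomputable def onSpace (M : Mesh d) (h : ℝ) (w : Grid d → Phase N) : Space d → Phase N :=
  fun x => w (M.cell h x)

/-! ### Stability and consistency conditions on the computed solutions

Below `u h ω t i` is the value at time `t` in cell `i` computed with mesh size `h` for the
realization `ω`. -/

variable {Ω : Type*}

/-- Weak BV bound: for some `1 ≤ r < ∞`, and for all `ω` and `T`,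
`∫_0^T ∑_i ∑_k |u_{i+e_k} - u_i|^r Δx_1 ⋯ Δx_d dt → 0` as `h → 0`. -/
def WeakBV (M : Mesh d) (u : ℝ → Ω → ℝ → Grid d → Phase N) : Prop :=
  ∃ r : ℝ, 1 ≤ r ∧ ∀ (ω : Ω) (T : ℝ), 0 < T →
    Tendsto (fun h => ∫⁻ t in Ioc 0 T, ∑' i : Grid d, ∑ k,
        ‖u h ω t (i + Pi.single k 1) - u h ω t i‖ₑ ^ r * ENNReal.ofReal (∏ l, M.width h l))
      (𝓝[>] 0) (𝓝 0)

/-- Entropy consistency with respect to `(η, q)`: there is a numerical entropy flux `Q`, consistent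
with `q` and locally Lipschitz, such that `d/dt η(u_i) + ∑_k (Q^k_{i+e_k/2} - Q^k_{i-e_k/2}) / Δx_k ≤ 0`
(for almost every `t > 0`, as the solutions of the scheme are Lipschitz continuous in time). -/
def EntropyConsistent (M : Mesh d) (η : Phase N → ℝ) (q : Fin d → Phase N → ℝ)
    (u : ℝ → Ω → ℝ → Grid d → Phase N) : Prop :=
  ∃ p : ℕ, 1 ≤ p ∧ ∃ Q : Fin d → ℝ → (stencil d p → Phase N) → ℝ,
    (∀ k, ConsistentFlux (Q k) (q k)) ∧
    ∀ h : ℝ, 0 < h → ∀ (ω : Ω) (i : Grid d), ∀ᵐ t ∂(volume.restrict (Ioi (0 : ℝ))),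
      deriv (fun s => η (u h ω s i)) t + fluxDifference M h (fun k => Q k h) (u h ω t) i ≤ 0

/-- Consistency of the means of the initial data: `∫ ψ ⟨σ^h, id⟩ dx → ∫ ψ ⟨σ, id⟩ dx`. -/
def MeanConsistent (σh : ℝ → Space d → Measure (Phase N)) (σ : Space d → Measure (Phase N)) :
    Prop :=
  ∀ ψ : Space d → ℝ, IsSpatialTest ψ →
    Tendsto (fun h => ∫ x, ψ x • ∫ ξ, ξ ∂(σh h x)) (𝓝[>] 0) (𝓝 (∫ x, ψ x • ∫ ξ, ξ ∂(σ x)))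

/-- Consistency of the initial data with respect to the entropy `η`:
`limsup_{h → 0} ∫ ψ ⟨σ^h, η⟩ dx ≤ ∫ ψ ⟨σ, η⟩ dx` for `ψ ≥ 0`, where `⟨σ, η⟩` is well defined. -/
def EntropyMeanConsistent (η : Phase N → ℝ) (σh : ℝ → Space d → Measure (Phase N))
    (σ : Space d → Measure (Phase N)) : Prop :=
  PairingLocallyIntegrable volume σ η ∧
  ∀ ψ : Space d → ℝ, IsSpatialTest ψ → (∀ x, 0 ≤ ψ x) →
    limsup (fun h => ((∫ x, ψ x * ∫ ξ, η ξ ∂(σh h x) : ℝ) : EReal)) (𝓝[>] 0)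
      ≤ ((∫ x, ψ x * ∫ ξ, η ξ ∂(σ x) : ℝ) : EReal)

end Scheme

end EMV

/-!
Young measures bounded by a constant `C` are handled as *couplings*: probability measures on
`(space-time) × (closed ball of radius C)` whose first marginal is a fixed probability measure
equivalent to Lebesgue measure on `ℝᵈ × ℝ₊`. The set of couplings is compact by Prokhorov's theorem
(`isCompact_couplings`) and metrizable, weak convergence of couplings is weak* convergence of Young
measures (`tendsto_couplingPairing`), and disintegrating a coupling returns a Young measure
(`youngOfCoupling`).

*A single realization.* Let `(η, q)` be an entropy pair satisfied by the scheme in the sense of the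
discrete entropy inequality. Testing that inequality against the values of a nonnegative test
function `φ`, integrating by parts in time and summing by parts in space, leaves
`∫ ∂ₜφ η(u) + ∑ₖ ∂ₖφ qᵏ(u)` plus the initial term, up to the error of replacing numerical fluxes by
`qᵏ(u)`. The fluxes being consistent and Lipschitz on the ball of radius `C`, the error is bounded by
the jumps of `u` between cells, which vanish in the limit by the weak BV bound
(`tendsto_integral_jump`). Hence the entropy production is asymptotically nonnegative
(`eventually_neg_le_entropyBalance`).

*Expectation.* All quantities are bounded uniformly in `ω`, so taking expectations and passing to the
limit `Δx → 0` along a convergent subsequence of couplings gives, for each fixed `ε`, the entropy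
inequality with initial datum the law of `u₀ + ε X` (`entropyProduction_add_nonneg`). The mean
equation needs no separate argument: for a linear functional `ℓ`, the pair `(ℓ, ℓ ∘ f)` is an entropy
pair for which the scheme has an exact discrete equality (`entropyConsistent_linear`), and the
inequalities for `ℓ` and `-ℓ` together say that the `ℓ`-component of the mean equation holds.

*Vanishing perturbation.* By convexity,
`η (u₀ + ε X) ≤ (1 - ε / ε₀) η (u₀) + (ε / ε₀) η (u₀ + ε₀ X)`, so the initial term for `ε` is at most
`∫ φ(·, 0) η(u₀) + O(ε)` (`integral_mul_law_le_of_convex`); no growth condition on `η` is needed.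
A convergent subsequence as `ε → 0` yields a coupling satisfying the inequalities with initial datum
`δ_{u₀}` (`entropyProduction_add_atomic_nonneg`), whose disintegration is therefore an entropy
measure-valued solution (`youngOfCoupling_mem_emvSolutions`). A diagonal sequence
(`exists_diagonal_tendsto`) realizes it as a limit of the laws of the numerical solutions.
-/

namespace EMV

set_option linter.unusedSectionVars false

/-! ### Young measures as couplings with a fixed marginal -/

section Couplings

open BoundedContinuousFunction

variable {D Y : Type*} [TopologicalSpace D] [PolishSpace D] [MeasurableSpace D] [BorelSpace D]
  [TopologicalSpace Y] [PolishSpace Y] [CompactSpace Y] [MeasurableSpace Y] [BorelSpace Y]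

/-- The Young measures from `(D, lam)` to `Y`, encoded through disintegration as the probability
measures on `D × Y` with first marginal `lam`. -/
def couplings (Y : Type*) [MeasurableSpace Y] (lam : Measure D) :
    Set (ProbabilityMeasure (D × Y)) :=
  {μ | (μ : Measure (D × Y)).map Prod.fst = lam}

theorem measurePreserving_fst {lam : Measure D} {μ : ProbabilityMeasure (D × Y)}
    (hμ : μ ∈ couplings Y lam) : MeasurePreserving Prod.fst (μ : Measure (D × Y)) lam :=
  ⟨measurable_fst, hμ⟩

/-- Prokhorov's theorem applies because all couplings share the tight marginal `lam`, while `Y` is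
compact. -/
theorem isCompact_couplings (lam : Measure D) [IsProbabilityMeasure lam] :
    IsCompact (couplings Y lam) := by
  have hcl : IsClosed (couplings Y lam) := by
    let L : ProbabilityMeasure D := ⟨lam, inferInstance⟩
    have : couplings Y lam =
        (fun μ : ProbabilityMeasure (D × Y) => μ.map (continuous_fst.measurable.aemeasurable)) ⁻¹'
          {L} := by
      ext μ
      exact ⟨fun h => Subtype.ext h, fun h => congrArg Subtype.val h⟩
    rw [this]
    exact isClosed_singleton.preimage (ProbabilityMeasure.continuous_map continuous_fst)
  rw [← hcl.closure_eq]
  apply isCompact_closure_of_isTightMeasureSet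
  rw [isTightMeasureSet_iff_exists_isCompact_measure_compl_le]
  intro ε hε
  obtain ⟨K, hK, hKε⟩ := isTightMeasureSet_iff_exists_isCompact_measure_compl_le.1
    (isTightMeasureSet_singleton (μ := lam)) ε hε
  refine ⟨K ×ˢ univ, hK.prod isCompact_univ, ?_⟩
  rintro _ ⟨μ, hμ, rfl⟩
  have : (K ×ˢ (univ : Set Y))ᶜ = Prod.fst ⁻¹' Kᶜ := by ext; simp
  rw [this, (measurePreserving_fst hμ).measure_preimage hK.measurableSet.compl.nullMeasurableSet]
  exact hKε lam rfl

theorem integrable_mul_of_coupling {lam : Measure D} {μ : ProbabilityMeasure (D × Y)}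
    (hμ : μ ∈ couplings Y lam) {φ : D → ℝ} (hφ : Integrable φ lam) {g : Y → ℝ}
    (hg : Continuous g) : Integrable (fun p : D × Y => φ p.1 * g p.2) (μ : Measure (D × Y)) := by
  obtain ⟨B, hB⟩ := isCompact_univ.exists_bound_of_continuousOn hg.continuousOn
  refine Integrable.mul_bdd (c := B) ((measurePreserving_fst hμ).integrable_comp_of_integrable hφ)
    (hg.measurable.comp measurable_snd).aestronglyMeasurable (Eventually.of_forall fun p => ?_)
  exact hB _ (mem_univ _)

/-- On couplings, weak convergence of measures improves to convergence against `φ ⊗ g` with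
`φ` merely integrable, since continuous bounded functions are dense in `L¹(lam)`. -/
theorem tendsto_integral_mul_of_couplings {ι : Type*} {l : Filter ι} {lam : Measure D}
    [IsProbabilityMeasure lam] {μs : ι → ProbabilityMeasure (D × Y)}
    {μ : ProbabilityMeasure (D × Y)} (hμs : ∀ᶠ i in l, μs i ∈ couplings Y lam)
    (hμ : μ ∈ couplings Y lam) (hlim : Tendsto μs l (𝓝 μ)) {φ : D → ℝ} (hφ : Integrable φ lam)
    {g : Y → ℝ} (hg : Continuous g) :
    Tendsto (fun i => ∫ p, φ p.1 * g p.2 ∂(μs i : Measure (D × Y))) l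
      (𝓝 (∫ p, φ p.1 * g p.2 ∂(μ : Measure (D × Y)))) := by
  obtain ⟨B, hB⟩ := isCompact_univ.exists_bound_of_continuousOn hg.continuousOn
  have hB' : ∀ y, ‖g y‖ ≤ |B| + 1 := fun y => by
    linarith [hB y (mem_univ _), le_abs_self B]
  have hBpos : 0 < |B| + 1 := by positivity
  rw [Metric.tendsto_nhds]
  intro ε hε
  obtain ⟨ψ, hψ, hψi⟩ := hφ.exists_boundedContinuous_integral_sub_le
    (ε := ε / (4 * (|B| + 1))) (by positivity)
  have key : ∀ m ∈ couplings Y lam,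
      dist (∫ p, φ p.1 * g p.2 ∂(m : Measure (D × Y)))
        (∫ p, ψ p.1 * g p.2 ∂(m : Measure (D × Y))) ≤ ε / 4 := by
    intro m hm
    rw [dist_eq_norm, ← integral_sub (integrable_mul_of_coupling hm hφ hg)
      (integrable_mul_of_coupling hm hψi hg)]
    have h1 : Integrable (fun p : D × Y => ‖φ p.1 - ψ p.1‖) (m : Measure (D × Y)) :=
      (measurePreserving_fst hm).integrable_comp_of_integrable (hφ.sub hψi).norm
    calc _ ≤ ∫ p : D × Y, ‖φ p.1 - ψ p.1‖ * (|B| + 1) ∂(m : Measure (D × Y)) := by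
          refine norm_integral_le_of_norm_le (h1.mul_const _) (Eventually.of_forall fun p => ?_)
          rw [← sub_mul, norm_mul]
          exact mul_le_mul_of_nonneg_left (hB' _) (norm_nonneg _)
      _ = (∫ z, ‖φ z - ψ z‖ ∂lam) * (|B| + 1) := by
          rw [integral_mul_const]
          congr 1
          have hm' : (m : Measure (D × Y)).map Prod.fst = lam := hm
          rw [← hm', integral_map measurable_fst.aemeasurable]
          rw [hm']
          exact (hφ.sub hψi).norm.aestronglyMeasurable
      _ ≤ ε / (4 * (|B| + 1)) * (|B| + 1) := by gcongr
      _ = ε / 4 := by field_simp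
  let F : D × Y →ᵇ ℝ := BoundedContinuousFunction.ofNormedAddCommGroup
    (fun p => ψ p.1 * g p.2) (by fun_prop) (‖ψ‖ * (|B| + 1)) (fun p => by
      rw [norm_mul]; exact mul_le_mul (ψ.norm_coe_le_norm _) (hB' _) (norm_nonneg _)
        (norm_nonneg _))
  have hF := (ProbabilityMeasure.tendsto_iff_forall_integral_tendsto.1 hlim) F
  rw [Metric.tendsto_nhds] at hF
  filter_upwards [hμs, hF (ε / 4) (by positivity)] with i hi hFi
  have h1 := key _ hi
  have h2 := key _ hμ
  have h3 : dist (∫ p, ψ p.1 * g p.2 ∂(μs i : Measure (D × Y)))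
      (∫ p, ψ p.1 * g p.2 ∂(μ : Measure (D × Y))) < ε / 4 := hFi
  rw [Real.dist_eq] at *
  rw [abs_lt] at *
  rw [abs_le] at *
  constructor <;> linarith [h1.1, h1.2, h2.1, h2.2, h3.1, h3.2]

/-! ### The pairing of a coupling with `φ ⊗ g` -/

/-- The number `∫ φ(z) ⟨ν_z, g⟩ dm(z)` for the Young measure `ν` with coupling `μ`. The first
marginal of `μ` is the probability measure `m.toFinite`, which is equivalent to `m`, whence the
density. -/
noncomputable def couplingPairing (m : Measure D) [SFinite m] (φ : D → ℝ) (g : Y → ℝ)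
    (μ : Measure (D × Y)) : ℝ :=
  ∫ p, ((m.rnDeriv m.toFinite p.1).toReal * φ p.1) * g p.2 ∂μ

theorem integrable_density_mul {m : Measure D} [SigmaFinite m] {φ : D → ℝ}
    (hφ : Integrable φ m) :
    Integrable (fun z => (m.rnDeriv m.toFinite z).toReal * φ z) m.toFinite :=
  (integrable_rnDeriv_smul_iff (absolutelyContinuous_toFinite m)).2 hφ

theorem tendsto_couplingPairing {ι : Type*} {l : Filter ι} {m : Measure D} [SigmaFinite m]
    [NeZero m] {μs : ι → ProbabilityMeasure (D × Y)}
    {μ : ProbabilityMeasure (D × Y)} (hμs : ∀ᶠ i in l, μs i ∈ couplings Y m.toFinite)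
    (hμ : μ ∈ couplings Y m.toFinite) (hlim : Tendsto μs l (𝓝 μ)) {φ : D → ℝ}
    (hφ : Integrable φ m) {g : Y → ℝ} (hg : Continuous g) :
    Tendsto (fun i => couplingPairing m φ g (μs i : Measure (D × Y))) l
      (𝓝 (couplingPairing m φ g (μ : Measure (D × Y)))) :=
  tendsto_integral_mul_of_couplings hμs hμ hlim (integrable_density_mul hφ) hg

theorem couplingPairing_eq_condKernel [Nonempty Y] {m : Measure D} [SigmaFinite m]
    {μ : ProbabilityMeasure (D × Y)} (hμ : μ ∈ couplings Y m.toFinite)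
    {φ : D → ℝ} (hφ : Integrable φ m) {g : Y → ℝ} (hg : Continuous g) :
    couplingPairing m φ g (μ : Measure (D × Y))
      = ∫ z, φ z * ∫ y, g y ∂((μ : Measure (D × Y)).condKernel z) ∂m := by
  have h1 : (μ : Measure (D × Y)).fst = m.toFinite := hμ
  rw [couplingPairing, ← Measure.integral_condKernel
    (integrable_mul_of_coupling hμ (integrable_density_mul hφ) hg), h1,
    ← integral_rnDeriv_smul (absolutelyContinuous_toFinite m)]
  refine integral_congr_ae (Eventually.of_forall fun z => ?_)
  simp only [integral_const_mul, smul_eq_mul, mul_assoc]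

variable {Ω : Type*} [MeasurableSpace Ω]

/-- The coupling that encodes the law of a random field `U`. -/
noncomputable def fieldCoupling (m : Measure D) [SFinite m] [NeZero m] (P : Measure Ω)
    [IsProbabilityMeasure P] (U : D × Ω → Y) (hU : Measurable U) : ProbabilityMeasure (D × Y) :=
  ⟨(m.toFinite.prod P).map fun p => (p.1, U p),
    Measure.isProbabilityMeasure_map (measurable_fst.prodMk hU).aemeasurable⟩

theorem fieldCoupling_mem (m : Measure D) [SFinite m] [NeZero m] (P : Measure Ω)
    [IsProbabilityMeasure P] (U : D × Ω → Y) (hU : Measurable U) :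
    fieldCoupling m P U hU ∈ couplings Y m.toFinite := by
  change ((m.toFinite.prod P).map fun p => (p.1, U p)).map Prod.fst = m.toFinite
  rw [Measure.map_map measurable_fst (measurable_fst.prodMk hU)]
  change (m.toFinite.prod P).map Prod.fst = _
  rw [Measure.map_fst_prod]; simp

theorem couplingPairing_fieldCoupling {m : Measure D} [SigmaFinite m] [NeZero m] (P : Measure Ω)
    [IsProbabilityMeasure P] (U : D × Ω → Y) (hU : Measurable U) {φ : D → ℝ}
    (hφ : Integrable φ m) {g : Y → ℝ} (hg : Continuous g) :
    couplingPairing m φ g (fieldCoupling m P U hU : Measure (D × Y))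
      = ∫ z, φ z * ∫ ω, g (U (z, ω)) ∂P ∂m := by
  have hi := integrable_mul_of_coupling (fieldCoupling_mem m P U hU) (integrable_density_mul hφ) hg
  have hmeas : Measurable fun p : D × Ω => (p.1, U p) := measurable_fst.prodMk hU
  change Integrable _ ((m.toFinite.prod P).map fun p => (p.1, U p)) at hi
  change ∫ p, _ ∂((m.toFinite.prod P).map fun p => (p.1, U p)) = _
  rw [integral_map hmeas.aemeasurable hi.aestronglyMeasurable, integral_prod]
  · rw [← integral_rnDeriv_smul (absolutelyContinuous_toFinite m)]
    refine integral_congr_ae (Eventually.of_forall fun z => ?_)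
    simp only [integral_const_mul, smul_eq_mul, mul_assoc]
  · exact (integrable_map_measure hi.aestronglyMeasurable hmeas.aemeasurable).1 hi

end Couplings

/-! ### Cells of a uniform mesh -/

section Cells

variable {d : ℕ} (M : Mesh d)

theorem Mesh.width_pos {h : ℝ} (hh : 0 < h) (k : Fin d) : 0 < M.width h k :=
  mul_pos (M.ratio_pos k) hh

theorem Mesh.cell_add_single {h : ℝ} (hh : 0 < h) (k : Fin d) (x : Space d) :
    M.cell h (x + Pi.single k (M.width h k)) = M.cell h x + Pi.single k 1 := by
  ext l
  have hw := M.width_pos hh l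
  by_cases hl : l = k
  · subst hl
    simp only [Mesh.cell, Pi.add_apply, Pi.single_eq_same]
    rw [← Int.floor_add_one]
    congr 1
    field_simp
    ring
  · simp [Mesh.cell, Pi.single_eq_of_ne hl]

theorem Mesh.measurable_cell (h : ℝ) : Measurable (M.cell h) := by
  refine measurable_pi_lambda _ fun k => ?_
  exact Int.measurable_floor.comp (((measurable_pi_apply k).sub_const _).div_const _)

theorem Mesh.volume_preimage_cell {h : ℝ} (hh : 0 < h) (i : Grid d) :
    volume (M.cell h ⁻¹' {i}) = ENNReal.ofReal (∏ l, M.width h l) := by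
  have : M.cell h ⁻¹' {i} = pi univ fun k =>
      Ico (M.corner h k + i k * M.width h k) (M.corner h k + (i k + 1) * M.width h k) := by
    ext x
    simp only [mem_preimage, mem_singleton_iff, Set.mem_pi, mem_univ, true_imp_iff, funext_iff,
      Mesh.cell, mem_Ico]
    refine forall_congr' fun k => ?_
    have hw := M.width_pos hh k
    rw [Int.floor_eq_iff, le_div_iff₀ hw, div_lt_iff₀ hw]
    constructor <;> rintro ⟨h1, h2⟩ <;> constructor <;> linarith
  rw [this, Real.volume_pi_Ico, ENNReal.ofReal_prod_of_nonneg fun l _ => (M.width_pos hh l).le]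
  refine Finset.prod_congr rfl fun k _ => ?_
  congr 1
  ring

theorem Mesh.lintegral_comp_cell {h : ℝ} (hh : 0 < h) (g : Grid d → ℝ≥0∞) :
    ∫⁻ x, g (M.cell h x) = ∑' i, g i * ENNReal.ofReal (∏ l, M.width h l) := by
  rw [← lintegral_map (measurable_of_countable g) (M.measurable_cell h), lintegral_countable']
  refine tsum_congr fun i => ?_
  rw [Measure.map_apply (M.measurable_cell h) (measurableSet_singleton i),
    M.volume_preimage_cell hh]

theorem Mesh.measurable_comp_cell {α : Type*} [MeasurableSpace α] {h : ℝ} {V : Type*}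
    [MeasurableSpace V] {g : α → Grid d → V} (hg : ∀ i, Measurable fun a => g a i) :
    Measurable fun z : Space d × α => g z.2 (M.cell h z.1) := by
  have h1 : Measurable fun p : α × Grid d => g p.1 p.2 := measurable_from_prod_countable_left hg
  exact h1.comp (measurable_snd.prodMk ((M.measurable_cell h).comp measurable_fst))

end Cells

theorem spaceTime_eq_prod (d : ℕ) :
    spaceTime d = (volume : Measure (Space d)).prod (volume.restrict (Ioi (0 : ℝ))) := by
  rw [spaceTime, Measure.volume_eq_prod, ← Measure.prod_restrict, Measure.restrict_univ,
    Measure.restrict_congr_set Ioi_ae_eq_Ici]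

instance (d : ℕ) : SigmaFinite (spaceTime d) := by unfold spaceTime; infer_instance

instance (d : ℕ) : IsLocallyFiniteMeasure (spaceTime d) := by unfold spaceTime; infer_instance

instance (d : ℕ) : NeZero (spaceTime d) := by
  refine ⟨fun h => ?_⟩
  have h1 : spaceTime d univ = 0 := by rw [h]; rfl
  rw [spaceTime_eq_prod, ← univ_prod_univ, Measure.prod_prod] at h1
  simp [NeZero.ne] at h1

/-! ### Consequences of the weak BV bound -/

section WeakBV

variable {d N : ℕ} {M : Mesh d}

/-- The integral over `(0, T]` of `∑_i |u_{i+m} - u_i|^r Δx_1 ⋯ Δx_d`. -/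
noncomputable def offsetJump (M : Mesh d) (u : ℝ → ℝ → Grid d → Phase N) (r T : ℝ) (m : Grid d)
    (h : ℝ) : ℝ≥0∞ :=
  ∫⁻ t in Ioc 0 T, ∑' i : Grid d,
    ‖u h t (i + m) - u h t i‖ₑ ^ r * ENNReal.ofReal (∏ l, M.width h l)

theorem offsetJump_add_le {u : ℝ → ℝ → Grid d → Phase N} {r T h : ℝ} (hr : 1 ≤ r)
    (hu : ∀ i, Continuous fun t => u h t i) (m n : Grid d) :
    offsetJump M u r T (m + n) h ≤
      2 ^ (r - 1) * (offsetJump M u r T m h + offsetJump M u r T n h) := by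
  have hmeas : ∀ m : Grid d, Measurable fun t => ∑' i : Grid d,
        ‖u h t (i + m) - u h t i‖ₑ ^ r * ENNReal.ofReal (∏ l, M.width h l) := fun m =>
    Measurable.tsum fun i =>
      ((((hu _).sub (hu _)).measurable.enorm).pow_const r).mul_const _
  unfold offsetJump
  rw [← lintegral_add_left (hmeas m)]
  refine le_of_le_of_eq ?_ (lintegral_const_mul _ ((hmeas m).add (hmeas n)))
  refine lintegral_mono fun t => ?_
  have hshift : ∑' i : Grid d,
      ‖u h t (i + m) - u h t i‖ₑ ^ r * ENNReal.ofReal (∏ l, M.width h l)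
      = ∑' i : Grid d, ‖u h t (i + (m + n)) - u h t (i + n)‖ₑ ^ r
        * ENNReal.ofReal (∏ l, M.width h l) := by
    rw [← (Equiv.addRight n).tsum_eq]
    refine tsum_congr fun i => ?_
    simp only [Equiv.coe_addRight]
    rw [add_assoc, add_comm n m]
  beta_reduce
  rw [hshift, ← ENNReal.tsum_add, ← ENNReal.tsum_mul_left]
  refine ENNReal.tsum_le_tsum fun i => ?_
  rw [← add_mul, ← mul_assoc]
  gcongr
  refine le_trans ?_ (ENNReal.rpow_add_le_mul_rpow_add_rpow _ _ hr)
  gcongr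
  have := enorm_add_le (u h t (i + (m + n)) - u h t (i + n)) (u h t (i + n) - u h t i)
  rwa [sub_add_sub_cancel] at this

theorem offsetJump_neg (u : ℝ → ℝ → Grid d → Phase N) (r T h : ℝ) (m : Grid d) :
    offsetJump M u r T (-m) h = offsetJump M u r T m h := by
  refine lintegral_congr fun t => ?_
  rw [← (Equiv.addRight m).tsum_eq]
  refine tsum_congr fun i => ?_
  simp only [Equiv.coe_addRight, add_neg_cancel_right]
  rw [← enorm_neg, neg_sub]

/-- The weak BV bound controls jumps between neighbouring cells; by the triangle inequality and
translation invariance of the sum over all cells, it controls jumps over any fixed offset. -/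
theorem tendsto_offsetJump {u : ℝ → ℝ → Grid d → Phase N}
    (hu : ∀ h, 0 < h → ∀ i, Continuous fun t => u h t i) {r T : ℝ} (hr : 1 ≤ r)
    (hbv : Tendsto (fun h => ∫⁻ t in Ioc 0 T, ∑' i : Grid d, ∑ k,
        ‖u h t (i + Pi.single k 1) - u h t i‖ₑ ^ r * ENNReal.ofReal (∏ l, M.width h l))
      (𝓝[>] 0) (𝓝 0)) (m : Grid d) :
    Tendsto (offsetJump M u r T m) (𝓝[>] 0) (𝓝 0) := by
  -- the offsets with this property form a subgroup, which contains the unit vectors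
  let A : AddSubgroup (Grid d) :=
    { carrier := {m | Tendsto (offsetJump M u r T m) (𝓝[>] 0) (𝓝 0)}
      zero_mem' := by
        have h0 : (0 : ℝ) < r := by linarith
        refine tendsto_const_nhds.congr fun h => ?_
        simp [offsetJump, h0]
      add_mem' := by
        intro m n hm hn
        have hlim := ENNReal.Tendsto.const_mul (a := (2 : ℝ≥0∞) ^ (r - 1)) (Tendsto.add hm hn)
          (Or.inr (ENNReal.rpow_ne_top_of_nonneg (by linarith) (by simp)))
        rw [add_zero, mul_zero] at hlim
        refine tendsto_of_tendsto_of_tendsto_of_le_of_le' tendsto_const_nhds hlim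
          (Eventually.of_forall fun _ => zero_le) ?_
        filter_upwards [self_mem_nhdsWithin] with h hh
        exact offsetJump_add_le hr (hu h hh) m n
      neg_mem' := by
        intro m hm
        exact Tendsto.congr (fun h => (offsetJump_neg u r T h m).symm) hm }
  have hsingle : ∀ k : Fin d, Pi.single k 1 ∈ A := by
    intro k
    refine tendsto_of_tendsto_of_tendsto_of_le_of_le tendsto_const_nhds hbv
      (fun _ => zero_le) fun h => ?_
    unfold offsetJump
    gcongr with t i
    refine le_trans ?_ (Finset.single_le_sum_of_canonicallyOrdered (Finset.mem_univ k))
    exact le_rfl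
  have hm : m ∈ A := by
    have : m = ∑ k, m k • (Pi.single k 1 : Grid d) := by
      ext l
      simp [Finset.sum_apply, Pi.single_apply]
    rw [this]
    exact A.sum_mem fun k _ => A.zsmul_mem (hsingle k) _
  exact hm

/-- Truncation at height `δ` reduces the `L¹` norm to the `r`-th power. -/
theorem le_add_rpow_mul_rpow {r : ℝ} (hr : 1 ≤ r) {a δ : ℝ≥0∞} (ha : a ≠ ∞) (hδ : δ ≠ 0) :
    a ≤ δ + δ ^ (1 - r) * a ^ r := by
  rcases le_total a δ with h | h
  · exact h.trans le_self_add
  · have ha0 : a ≠ 0 := fun h0 => hδ (le_antisymm (h0 ▸ h) (zero_le))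
    calc a = a ^ (1 - r) * a ^ r := by
          rw [← ENNReal.rpow_add _ _ ha0 ha, sub_add_cancel, ENNReal.rpow_one]
      _ ≤ δ ^ (1 - r) * a ^ r := by
          gcongr ?_ * _
          rw [← neg_sub, ENNReal.rpow_neg, ENNReal.rpow_neg, ENNReal.inv_le_inv]
          exact ENNReal.rpow_le_rpow h (by linarith)
      _ ≤ _ := le_add_self

/-- The truncation level `δ` makes the first part of the jumps small uniformly in the mesh size; the
weak BV bound in `Lʳ` then takes care of the rest. -/
theorem tendsto_integral_jump {u : ℝ → ℝ → Grid d → Phase N}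
    (hu : ∀ h, 0 < h → ∀ i, Continuous fun t => u h t i) {r : ℝ} (hr : 1 ≤ r)
    (hbv : ∀ T : ℝ, 0 < T → Tendsto (fun h => ∫⁻ t in Ioc 0 T, ∑' i : Grid d, ∑ k,
        ‖u h t (i + Pi.single k 1) - u h t i‖ₑ ^ r * ENNReal.ofReal (∏ l, M.width h l))
      (𝓝[>] 0) (𝓝 0)) (m : Grid d) {ψ : Space d × ℝ → ℝ} (hψ : Continuous ψ)
    (hψc : HasCompactSupport ψ) :
    Tendsto (fun h => ∫ z, ‖ψ z‖ * ‖u h z.2 (M.cell h z.1 + m) - u h z.2 (M.cell h z.1)‖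
      ∂(spaceTime d)) (𝓝[>] 0) (𝓝 0) := by
  obtain ⟨B, hB⟩ := hψc.exists_bound_of_continuous hψ
  obtain ⟨T, hT0, hT⟩ : ∃ T : ℝ, 0 < T ∧ ∀ z : Space d × ℝ, T < z.2 → ψ z = 0 := by
    obtain ⟨R, hR⟩ := hψc.isBounded.subset_closedBall 0
    refine ⟨max R 1, by positivity, fun z hz => ?_⟩
    by_contra hne
    have h1 := hR (subset_tsupport _ hne)
    rw [mem_closedBall_zero_iff] at h1
    have h2 : |z.2| ≤ ‖z‖ := norm_snd_le z
    have h3 := le_max_left R 1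
    have h4 := le_abs_self z.2
    linarith
  have hA : ∫⁻ z, ‖ψ z‖ₑ ∂(spaceTime d) ≠ ∞ :=
    (hψ.integrable_of_hasCompactSupport hψc).hasFiniteIntegral.ne
  have hV := tendsto_offsetJump hu hr (hbv T hT0) m
  have key : Tendsto (fun h => ∫⁻ z, ‖ψ z‖ₑ * ‖u h z.2 (M.cell h z.1 + m)
      - u h z.2 (M.cell h z.1)‖ₑ ∂(spaceTime d)) (𝓝[>] 0) (𝓝 0) := by
    rw [ENNReal.tendsto_nhds_zero]
    intro ε hε
    obtain ⟨δ, hδ, hδA⟩ := ENNReal.exists_nnreal_pos_mul_lt hA (ENNReal.half_pos hε.ne').ne'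
    have hδ0 : (δ : ℝ≥0∞) ≠ 0 := by simpa using hδ.ne'
    have hV' := ENNReal.Tendsto.const_mul (a := ENNReal.ofReal B * (δ : ℝ≥0∞) ^ (1 - r)) hV
      (Or.inr (ENNReal.mul_ne_top (by simp) (ENNReal.rpow_ne_top_of_ne_zero hδ0 (by simp))))
    rw [mul_zero, ENNReal.tendsto_nhds_zero] at hV'
    filter_upwards [hV' (ε / 2) (ENNReal.half_pos hε.ne'), self_mem_nhdsWithin] with h hh hpos
    have hpos : 0 < h := hpos
    have hmeas : Measurable fun z : Space d × ℝ =>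
        ‖u h z.2 (M.cell h z.1 + m) - u h z.2 (M.cell h z.1)‖ₑ :=
      (M.measurable_comp_cell (g := fun t i => u h t (i + m) - u h t i)
        fun i => ((hu h hpos _).sub (hu h hpos _)).measurable).enorm
    calc ∫⁻ z, ‖ψ z‖ₑ * ‖u h z.2 (M.cell h z.1 + m) - u h z.2 (M.cell h z.1)‖ₑ ∂(spaceTime d)
        ≤ ∫⁻ z, (‖ψ z‖ₑ * δ + (ENNReal.ofReal B * (δ : ℝ≥0∞) ^ (1 - r)) *
            (Iic T).indicator (fun _ => ‖u h z.2 (M.cell h z.1 + m)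
              - u h z.2 (M.cell h z.1)‖ₑ ^ r) z.2) ∂(spaceTime d) := by
          refine lintegral_mono fun z => ?_
          by_cases hz : T < z.2
          · simp [hT z hz]
          · rw [indicator_of_mem (by simpa using hz)]
            refine (mul_le_mul_right (le_add_rpow_mul_rpow hr enorm_ne_top hδ0) _).trans ?_
            rw [mul_add, mul_assoc]
            gcongr
            rw [← ofReal_norm]
            exact ENNReal.ofReal_le_ofReal (hB z)
      _ = (∫⁻ z, ‖ψ z‖ₑ ∂(spaceTime d)) * δ + (ENNReal.ofReal B * (δ : ℝ≥0∞) ^ (1 - r)) *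
            offsetJump M u r T m h := by
          have hm2 : Measurable fun z : Space d × ℝ => (Iic T).indicator
              (fun _ => ‖u h z.2 (M.cell h z.1 + m) - u h z.2 (M.cell h z.1)‖ₑ ^ r) z.2 := by
            have : (fun z : Space d × ℝ => (Iic T).indicator
              (fun _ => ‖u h z.2 (M.cell h z.1 + m) - u h z.2 (M.cell h z.1)‖ₑ ^ r) z.2)
              = (Prod.snd ⁻¹' Iic T).indicator (fun z =>
                ‖u h z.2 (M.cell h z.1 + m) - u h z.2 (M.cell h z.1)‖ₑ ^ r) := by
              ext z; simp [indicator]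
            rw [this]
            exact (hmeas.pow_const r).indicator (measurable_snd measurableSet_Iic)
          rw [lintegral_add_left (hψ.measurable.enorm.mul_const _),
            lintegral_mul_const _ hψ.measurable.enorm, lintegral_const_mul _ hm2]
          congr 2
          rw [offsetJump, spaceTime_eq_prod, lintegral_prod_symm _ hm2.aemeasurable, ← Ioi_inter_Iic,
            inter_comm, ← Measure.restrict_restrict measurableSet_Iic,
            ← lintegral_indicator measurableSet_Iic]
          refine lintegral_congr fun t => ?_
          by_cases ht : t ∈ Iic T
          · simp only [indicator_of_mem ht]
            exact M.lintegral_comp_cell hpos fun i => ‖u h t (i + m) - u h t i‖ₑ ^ r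
          · simp [indicator_of_notMem ht]
      _ ≤ ε / 2 + ε / 2 := by
          gcongr
          rw [mul_comm]
          exact hδA.le
      _ = ε := ENNReal.add_halves ε
  have := (ENNReal.tendsto_toReal ENNReal.zero_ne_top).comp key
  rw [ENNReal.toReal_zero] at this
  refine this.congr' ?_
  filter_upwards [self_mem_nhdsWithin] with h hpos
  have hpos : 0 < h := hpos
  have hmeas : Measurable fun z : Space d × ℝ =>
      ‖u h z.2 (M.cell h z.1 + m) - u h z.2 (M.cell h z.1)‖ :=
    (M.measurable_comp_cell (g := fun t i => u h t (i + m) - u h t i)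
      fun i => ((hu h hpos _).sub (hu h hpos _)).measurable).norm
  rw [integral_eq_lintegral_of_nonneg_ae (Eventually.of_forall fun z => by positivity)
    (by exact (hψ.measurable.norm.mul hmeas).aestronglyMeasurable)]
  simp only [Function.comp_apply]
  congr 1
  refine lintegral_congr fun z => ?_
  rw [ENNReal.ofReal_mul (norm_nonneg _), ofReal_norm, ofReal_norm]

end WeakBV

/-! ### Test functions -/

section TestFunctions

variable {d : ℕ}

theorem integrable_mul_of_bounded {α : Type*} [TopologicalSpace α] [MeasurableSpace α]
    [OpensMeasurableSpace α] {μ : Measure α} [IsFiniteMeasureOnCompacts μ] {ψ b : α → ℝ} {B : ℝ}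
    (hψ : Continuous ψ) (hψc : HasCompactSupport ψ) (hb : Measurable b) (hB : ∀ z, ‖b z‖ ≤ B) :
    Integrable (fun z => ψ z * b z) μ :=
  (hψ.integrable_of_hasCompactSupport hψc).mul_bdd hb.aestronglyMeasurable
    (Eventually.of_forall hB)

theorem IsTest.continuous_dt {φ : Space d × ℝ → ℝ} (hφ : IsTest φ) : Continuous (dt φ) :=
  (hφ.1.continuous_fderiv one_ne_zero).clm_apply continuous_const

theorem IsTest.continuous_dx {φ : Space d × ℝ → ℝ} (hφ : IsTest φ) (k : Fin d) :
    Continuous (dx k φ) :=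
  (hφ.1.continuous_fderiv one_ne_zero).clm_apply continuous_const

theorem IsTest.hasCompactSupport_dt {φ : Space d × ℝ → ℝ} (hφ : IsTest φ) :
    HasCompactSupport (dt φ) :=
  hφ.2.fderiv_apply (𝕜 := ℝ) _

theorem IsTest.hasCompactSupport_dx {φ : Space d × ℝ → ℝ} (hφ : IsTest φ) (k : Fin d) :
    HasCompactSupport (dx k φ) :=
  hφ.2.fderiv_apply (𝕜 := ℝ) _

theorem IsTest.integrable_dt {φ : Space d × ℝ → ℝ} (hφ : IsTest φ) :
    Integrable (dt φ) (spaceTime d) :=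
  hφ.continuous_dt.integrable_of_hasCompactSupport hφ.hasCompactSupport_dt

theorem IsTest.integrable_dx {φ : Space d × ℝ → ℝ} (hφ : IsTest φ) (k : Fin d) :
    Integrable (dx k φ) (spaceTime d) :=
  (hφ.continuous_dx k).integrable_of_hasCompactSupport (hφ.hasCompactSupport_dx k)

theorem IsTest.differentiable {φ : Space d × ℝ → ℝ} (hφ : IsTest φ) : Differentiable ℝ φ :=
  hφ.1.differentiable one_ne_zero

theorem hasCompactSupport_time_slice {φ : Space d × ℝ → ℝ} (hφ : HasCompactSupport φ) (t : ℝ) :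
    HasCompactSupport fun x => φ (x, t) :=
  hφ.comp_isClosedEmbedding
    (Isometry.of_dist_eq fun x y => by simp [Prod.dist_eq]).isClosedEmbedding

theorem hasCompactSupport_space_slice {φ : Space d × ℝ → ℝ} (hφ : HasCompactSupport φ)
    (x : Space d) : HasCompactSupport fun t => φ (x, t) :=
  hφ.comp_isClosedEmbedding
    (Isometry.of_dist_eq fun x y => by simp [Prod.dist_eq]).isClosedEmbedding

theorem IsTest.initial {φ : Space d × ℝ → ℝ} (hφ : IsTest φ) :
    IsSpatialTest fun x => φ (x, 0) :=
  ⟨hφ.1.comp (contDiff_id.prodMk contDiff_const), hasCompactSupport_time_slice hφ.2 0⟩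

/-- The forward difference quotient in direction `k` with increment `w`. -/
noncomputable def diffQuot (k : Fin d) (w : ℝ) (φ : Space d × ℝ → ℝ) (z : Space d × ℝ) : ℝ :=
  w⁻¹ * (φ (z.1 + Pi.single k w, z.2) - φ z)

theorem continuous_shift (k : Fin d) (w : ℝ) :
    Continuous fun z : Space d × ℝ => (z.1 + Pi.single k w, z.2) := by
  fun_prop

theorem IsTest.continuous_diffQuot {φ : Space d × ℝ → ℝ} (hφ : IsTest φ) (k : Fin d) (w : ℝ) :
    Continuous (diffQuot k w φ) :=
  continuous_const.mul ((hφ.1.continuous.comp (continuous_shift k w)).sub hφ.1.continuous)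

theorem IsTest.hasCompactSupport_diffQuot {φ : Space d × ℝ → ℝ} (hφ : IsTest φ) (k : Fin d)
    (w : ℝ) : HasCompactSupport (diffQuot k w φ) := by
  refine HasCompactSupport.mul_left (HasCompactSupport.sub ?_ hφ.2)
  exact hφ.2.comp_isClosedEmbedding
    (((Homeomorph.addRight (Pi.single k w : Space d)).prodCongr
      (Homeomorph.refl ℝ)).isClosedEmbedding)

/-- Difference quotients of a test function converge to its derivative in `L¹`, by dominated
convergence: they are bounded by a Lipschitz constant and have uniformly bounded supports. -/
theorem tendsto_integral_diffQuot_sub (M : Mesh d) {φ : Space d × ℝ → ℝ} (hφ : IsTest φ)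
    (k : Fin d) :
    Tendsto (fun h => ∫ z, ‖diffQuot k (M.width h k) φ z - dx k φ z‖ ∂(spaceTime d))
      (𝓝[>] 0) (𝓝 0) := by
  obtain ⟨L, hL⟩ := hφ.1.lipschitzWith_of_hasCompactSupport hφ.2 one_ne_zero
  obtain ⟨R, hR⟩ := hφ.2.isBounded.subset_closedBall 0
  have hzero : ∀ z : Space d × ℝ, R < ‖z‖ → φ z = 0 := by
    intro z hz
    by_contra hne
    have := hR (subset_tsupport _ hne)
    rw [mem_closedBall_zero_iff] at this
    linarith
  have hnorm : ∀ w : ℝ, ‖((Pi.single k w, 0) : Space d × ℝ)‖ = |w| := by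
    intro w
    rw [Prod.norm_def, Pi.norm_single]
    simp
  have hdx : ∀ z, ‖dx k φ z‖ ≤ L := fun z => by
    refine (ContinuousLinearMap.le_opNorm _ _).trans ?_
    rw [hnorm, abs_one, mul_one]
    exact norm_fderiv_le_of_lipschitz ℝ hL
  have hshift : ∀ (z : Space d × ℝ) w, (z.1 + Pi.single k w, z.2)
      = z + ((Pi.single k w, 0) : Space d × ℝ) := fun z w => by ext <;> simp
  have hquot : ∀ w, 0 < w → ∀ z, ‖diffQuot k w φ z‖ ≤ L := fun w hw z => by
    rw [diffQuot, norm_mul, hshift]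
    have := hL.dist_le_mul (z + ((Pi.single k w, 0) : Space d × ℝ)) z
    rw [dist_eq_norm, dist_eq_norm, add_sub_cancel_left, hnorm, abs_of_pos hw] at this
    calc ‖w⁻¹‖ * _ ≤ ‖w⁻¹‖ * (L * w) := by gcongr
      _ = L := by rw [norm_inv, Real.norm_of_nonneg hw.le]; field_simp
  have hlim : Tendsto (fun h => ∫ z, ‖diffQuot k (M.width h k) φ z - dx k φ z‖ ∂(spaceTime d))
      (𝓝[>] 0) (𝓝 (∫ _z, (0 : ℝ) ∂(spaceTime d))) := by
    refine tendsto_integral_filter_of_dominated_convergence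
      ((Metric.closedBall 0 (R + M.ratio k)).indicator fun _ => (L : ℝ) + L) ?_ ?_ ?_ ?_
    · exact Eventually.of_forall fun h =>
        ((hφ.continuous_diffQuot k _).sub (hφ.continuous_dx k)).norm.aestronglyMeasurable
    · filter_upwards [Ioc_mem_nhdsGT (zero_lt_one' ℝ)] with h hh
      refine Eventually.of_forall fun z => ?_
      rw [norm_norm]
      have hw := M.width_pos hh.1 k
      have hratio := M.ratio_pos k
      by_cases hz : z ∈ Metric.closedBall (0 : Space d × ℝ) (R + M.ratio k)
      · rw [indicator_of_mem hz]
        exact (norm_sub_le _ _).trans (add_le_add (hquot _ hw z) (hdx z))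
      · rw [indicator_of_notMem hz]
        rw [mem_closedBall_zero_iff, not_le] at hz
        have h1 : φ z = 0 := hzero z (by linarith)
        have h2 : φ (z.1 + Pi.single k (M.width h k), z.2) = 0 := by
          apply hzero
          rw [hshift]
          have h3 := norm_sub_norm_le z (-((Pi.single k (M.width h k), 0) : Space d × ℝ))
          rw [norm_neg, hnorm, sub_neg_eq_add, abs_of_pos hw] at h3
          have h4 : M.width h k ≤ M.ratio k := mul_le_of_le_one_right hratio.le hh.2
          linarith
        have h3 : dx k φ z = 0 := by
          have : z ∉ tsupport φ := fun hmem => by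
            have := hR hmem
            rw [mem_closedBall_zero_iff] at this
            linarith
          have h4 : fderiv ℝ φ z = 0 := by
            by_contra hne
            exact this (support_fderiv_subset ℝ hne)
          simp [dx, h4]
        simp [diffQuot, h1, h2, h3]
    · exact (integrable_indicator_iff Metric.isClosed_closedBall.measurableSet).2
        (integrableOn_const (isCompact_closedBall _ _).measure_lt_top.ne)
    · refine Eventually.of_forall fun z => ?_
      have hline : HasDerivAt (fun s : ℝ => φ (z + s • ((Pi.single k 1, 0) : Space d × ℝ)))
          (dx k φ z) 0 :=
        ((hφ.differentiable z).hasFDerivAt.hasLineDerivAt _)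
      rw [hasDerivAt_iff_tendsto_slope_zero] at hline
      have hw0 : Tendsto (fun h => M.width h k) (𝓝[>] 0) (𝓝[≠] 0) := by
        refine tendsto_nhdsWithin_iff.2 ⟨?_, ?_⟩
        · have : Tendsto (fun h : ℝ => M.ratio k * h) (𝓝 0) (𝓝 (M.ratio k * 0)) :=
            tendsto_const_nhds.mul tendsto_id
          rw [mul_zero] at this
          exact this.mono_left nhdsWithin_le_nhds
        · filter_upwards [self_mem_nhdsWithin] with h hh
          exact (M.width_pos hh k).ne'
      have h1 := hline.comp hw0
      have h2 : Tendsto (fun h => diffQuot k (M.width h k) φ z) (𝓝[>] 0) (𝓝 (dx k φ z)) := by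
        refine h1.congr fun h => ?_
        simp only [Function.comp_apply, zero_add, zero_smul, add_zero, smul_eq_mul, diffQuot]
        rw [hshift]
        congr 4
        ext l
        · by_cases hl : l = k
          · subst hl; simp
          · simp [hl]
        · simp
      have h3 := (h2.sub_const (dx k φ z)).norm
      simpa using h3
  simpa using hlim

end TestFunctions

/-! ### Integration by parts in time and summation by parts in space -/

section Parts

variable {d N : ℕ} {M : Mesh d}

theorem integral_Ioi_mul_deriv_of_lipschitz {g θ : ℝ → ℝ} {K : NNReal} (hg : LipschitzWith K g)
    (hθ : ContDiff ℝ 1 θ) (hθc : HasCompactSupport θ) :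
    ∫ t in Ioi 0, θ t * deriv g t = -(θ 0 * g 0) - ∫ t in Ioi 0, deriv θ t * g t := by
  obtain ⟨R, hR⟩ := hθc.isBounded.subset_closedBall 0
  have hsupp : ∀ t, max R 0 < t → t ∉ tsupport θ := fun t ht hmem => by
    have h1 := hR hmem
    rw [mem_closedBall_zero_iff, Real.norm_eq_abs] at h1
    have h2 := le_abs_self t
    have h3 := le_max_left R 0
    linarith
  set T := max R 0 + 1 with hTdef
  have hT0 : 0 ≤ T := by positivity
  have hθ0 : ∀ t, max R 0 < t → θ t = 0 := fun t ht => image_eq_zero_of_notMem_tsupport (hsupp t ht)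
  have hdθ0 : ∀ t, max R 0 < t → deriv θ t = 0 := fun t ht => by
    by_contra hne
    exact hsupp t ht (support_deriv_subset hne)
  have hcut : ∀ F : ℝ → ℝ, (∀ t, max R 0 < t → F t = 0) →
      ∫ t in Ioi 0, F t = ∫ t in (0 : ℝ)..T, F t := by
    intro F hF
    rw [intervalIntegral.integral_of_le hT0]
    refine setIntegral_eq_of_subset_of_forall_sdiff_eq_zero measurableSet_Ioi
      Ioc_subset_Ioi_self fun t ht => hF t ?_
    have h1 : ¬ t ≤ T := fun h => ht.2 ⟨ht.1, h⟩
    linarith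
  rw [hcut _ fun t ht => by rw [hθ0 t ht, zero_mul], hcut _ fun t ht => by rw [hdθ0 t ht, zero_mul],
    AbsolutelyContinuousOnInterval.integral_mul_deriv_eq_deriv_mul
      (hθ.contDiffOn.absolutelyContinuousOnInterval)
      ((hg.lipschitzOnWith (s := uIcc 0 T)).absolutelyContinuousOnInterval),
    hθ0 T (by linarith)]
  ring

/-- Summation by parts on the mesh, written with integrals over `ℝ^d`: the translation by one cell
preserves Lebesgue measure and moves the cell index by `e k`. -/
theorem integral_mul_le_sum_integral_diffQuot {h : ℝ} {e : Fin d → Grid d}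
    (he : ∀ k x, M.cell h (x + Pi.single k (M.width h k)) = M.cell h x + e k) {a : Grid d → ℝ}
    {G : Fin d → Grid d → ℝ} {A : ℝ} {B : Fin d → ℝ} (ha : ∀ i, ‖a i‖ ≤ A)
    (hG : ∀ k i, ‖G k i‖ ≤ B k)
    (hle : ∀ i, a i + ∑ k, (M.width h k)⁻¹ * (G k i - G k (i - e k)) ≤ 0)
    {φ : Space d × ℝ → ℝ} (hφ : IsTest φ) {t : ℝ} (hpos : ∀ x, 0 ≤ φ (x, t)) :
    ∫ x, φ (x, t) * a (M.cell h x) ≤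
      ∑ k, ∫ x, diffQuot k (M.width h k) φ (x, t) * G k (M.cell h x) := by
  have hcont : Continuous fun x => φ (x, t) := hφ.1.continuous.comp (by fun_prop)
  have hcs := hasCompactSupport_time_slice hφ.2 t
  have hmeas : ∀ g : Grid d → ℝ, Measurable fun x => g (M.cell h x) := fun g =>
    (measurable_of_countable g).comp (M.measurable_cell h)
  have hint : ∀ (g : Grid d → ℝ) (b : ℝ), (∀ i, ‖g i‖ ≤ b) →
      Integrable fun x => φ (x, t) * g (M.cell h x) := fun g b hb =>
    integrable_mul_of_bounded hcont hcs (hmeas g) fun x => hb _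
  have hk : ∀ k, ∫ x, diffQuot k (M.width h k) φ (x, t) * G k (M.cell h x)
      = -∫ x, φ (x, t) * ((M.width h k)⁻¹ *
        (G k (M.cell h x) - G k (M.cell h x - e k))) := by
    intro k
    have hI1 := hint (G k) (B k) (hG k)
    have hI2 := hint (fun i => G k (i - e k)) (B k) (fun i => hG k _)
    have hI3 : Integrable fun x =>
        φ (x + Pi.single k (M.width h k), t) * G k (M.cell h x) := by
      have := hI2.comp_add_right (Pi.single k (M.width h k))
      refine this.congr (Eventually.of_forall fun x => ?_)
      simp only [he, add_sub_cancel_right]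
    have hshift : ∫ x, φ (x + Pi.single k (M.width h k), t) * G k (M.cell h x)
        = ∫ x, φ (x, t) * G k (M.cell h x - e k) := by
      have := integral_add_right_eq_self (μ := volume)
        (fun x => φ (x, t) * G k (M.cell h x - e k)) (Pi.single k (M.width h k))
      simp only [he, add_sub_cancel_right] at this
      exact this
    have e1 : (fun x => diffQuot k (M.width h k) φ (x, t) * G k (M.cell h x)) = fun x =>
        (M.width h k)⁻¹ * (φ (x + Pi.single k (M.width h k), t) * G k (M.cell h x)
          - φ (x, t) * G k (M.cell h x)) := by
      ext x; simp only [diffQuot]; ring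
    have e2 : (fun x => φ (x, t) * ((M.width h k)⁻¹ *
        (G k (M.cell h x) - G k (M.cell h x - e k)))) = fun x =>
        (M.width h k)⁻¹ * (φ (x, t) * G k (M.cell h x)
          - φ (x, t) * G k (M.cell h x - e k)) := by
      ext x; ring
    rw [e1, e2, integral_const_mul, integral_const_mul, integral_sub hI3 hI1,
      integral_sub hI1 hI2, hshift]
    ring
  have hIk : ∀ k, Integrable fun x => φ (x, t) * ((M.width h k)⁻¹ *
        (G k (M.cell h x) - G k (M.cell h x - e k))) := fun k =>
    hint (fun i => (M.width h k)⁻¹ * (G k i - G k (i - e k)))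
      (‖(M.width h k)⁻¹‖ * (B k + B k)) fun i => by
        rw [norm_mul]
        gcongr
        exact (norm_sub_le _ _).trans (add_le_add (hG k _) (hG k _))
  simp_rw [hk]
  rw [Finset.sum_neg_distrib, ← integral_finsetSum _ fun k _ => hIk k, ← integral_neg]
  refine integral_mono (hint a A ha) (integrable_finsetSum _ fun k _ => hIk k).neg fun x => ?_
  simp only [← Finset.mul_sum]
  rw [← mul_neg]
  exact mul_le_mul_of_nonneg_left (by linarith [hle (M.cell h x)]) (hpos x)

end Parts

/-! ### The discrete entropy inequality for a single realization -/

section Deterministic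

variable {d N : ℕ} {M : Mesh d}

/-- The left-hand side of the weak entropy inequality for the function `U` on space-time, with
initial values `U (·, 0)`. -/
noncomputable def entropyBalance (φ : Space d × ℝ → ℝ) (η : Phase N → ℝ) (q : Fin d → Phase N → ℝ)
    (U : Space d × ℝ → Phase N) : ℝ :=
  (∫ z, (dt φ z * η (U z) + ∑ k, dx k φ z * q k (U z)) ∂(spaceTime d))
    + ∫ x, φ (x, 0) * η (U (x, 0))

theorem exists_bound_on_ball {V : Type*} [NormedAddCommGroup V] {g : Phase N → V}
    (hg : Continuous g) (C : ℝ) :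
    ∃ B, 0 ≤ B ∧ ∀ ξ, ‖ξ‖ ≤ C → ‖g ξ‖ ≤ B := by
  obtain ⟨B, hB⟩ := (isCompact_closedBall (0 : Phase N) C).exists_bound_of_continuousOn
    hg.continuousOn
  refine ⟨max B 0, le_max_right _ _, fun ξ hξ => (hB ξ ?_).trans (le_max_left _ _)⟩
  simpa using hξ

/-- On values bounded by `C`, a consistent flux is close to the exact one up to the jumps over the
stencil, and bounded independently of the mesh size. -/
theorem ConsistentFlux.exists_bound {V : Type*} [NormedAddCommGroup V] {p : ℕ}
    {F : ℝ → (stencil d p → Phase N) → V} {g : Phase N → V} (hF : ConsistentFlux F g)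
    (hg : Continuous g) (C : ℝ) :
    ∃ c B : ℝ, 0 ≤ B ∧ ∀ h, 0 < h → ∀ w : Grid d → Phase N, (∀ i, ‖w i‖ ≤ C) → ∀ i,
      ‖F h (atCell p w i) - g (w i)‖ ≤ c * ∑ m ∈ stencil d p, ‖w (i + m) - w i‖ ∧
      ‖F h (atCell p w i)‖ ≤ B := by
  obtain ⟨c, hc0, hc⟩ := hF _ (isCompact_closedBall (0 : Phase N) C)
  obtain ⟨B, hB0, hB⟩ := exists_bound_on_ball hg C
  refine ⟨c, max (B + c * ∑ m ∈ stencil d p, (C + C)) 0, le_max_right _ _,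
    fun h hh w hw i => ?_⟩
  have h1 := hc h hh (fun m => w (i + m)) fun m _ => by simpa using hw (i + m)
  have h2 : atCell p (fun m => w (i + m)) 0 = atCell p w i := by
    funext m
    simp [atCell]
  simp only [h2, add_zero] at h1
  refine ⟨h1, le_trans ?_ (le_max_left _ _)⟩
  have h3 := norm_add_le (F h (atCell p w i) - g (w i)) (g (w i))
  rw [sub_add_cancel] at h3
  have h4 : c * ∑ m ∈ stencil d p, ‖w (i + m) - w i‖ ≤ c * ∑ m ∈ stencil d p, (C + C) := by
    gcongr with m _
    exact (norm_sub_le _ _).trans (add_le_add (hw _) (hw _))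
  linarith [hB _ (hw i)]

theorem exists_lipschitzWith_comp {η : Phase N → ℝ} (hη : LocallyLipschitz η) {C : ℝ} {K : NNReal}
    {w : ℝ → Grid d → Phase N} (hC : ∀ t i, ‖w t i‖ ≤ C)
    (hw : ∀ i, LipschitzWith K fun t => w t i) :
    ∃ L, ∀ i, LipschitzWith L fun t => η (w t i) := by
  obtain ⟨L, hL⟩ := LocallyLipschitzOn.exists_lipschitzOnWith_of_compact
    (isCompact_closedBall (0 : Phase N) C) hη.locallyLipschitzOn
  refine ⟨L * K, fun i => ?_⟩
  rw [← lipschitzOnWith_univ]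
  exact hL.comp ((hw i).lipschitzOnWith) fun t _ => by simpa using hC t i

/-- The weak entropy inequality for a single mesh size with an explicit error. The error consists of
the difference between difference quotients and derivatives of `φ`, and of the jumps that bound the
distance between the numerical flux `G` and `q (w)`. The flux `G` need not be measurable in time: it enters only through pointwise
inequalities, and is replaced by `q (w)` before integrating in time. -/
theorem neg_error_le_entropyBalance {h : ℝ} {e : Fin d → Grid d}
    (he : ∀ k x, M.cell h (x + Pi.single k (M.width h k)) = M.cell h x + e k)
    {w : ℝ → Grid d → Phase N} {C : ℝ} {K : NNReal} (hC : ∀ t i, ‖w t i‖ ≤ C)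
    (hw : ∀ i, LipschitzWith K fun t => w t i) {η : Phase N → ℝ} (hη : LocallyLipschitz η)
    {q : Fin d → Phase N → ℝ} (hq : ∀ k, Continuous (q k)) {G : Fin d → ℝ → Grid d → ℝ}
    {B c : Fin d → ℝ} (hB : ∀ k t i, ‖G k t i‖ ≤ B k) {s : Finset (Grid d)}
    (hc : ∀ k t i, ‖G k t i - q k (w t i)‖ ≤ c k * ∑ m ∈ s, ‖w t (i + m) - w t i‖)
    (hent : ∀ i, ∀ᵐ t ∂(volume.restrict (Ioi (0 : ℝ))), deriv (fun s => η (w s i)) t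
      + ∑ k, (M.width h k)⁻¹ * (G k t i - G k t (i - e k)) ≤ 0)
    {φ : Space d × ℝ → ℝ} (hφ : IsTest φ) (hpos : ∀ x t, 0 ≤ t → 0 ≤ φ (x, t)) :
    -(∑ k, (B k * ∫ z, ‖diffQuot k (M.width h k) φ z - dx k φ z‖ ∂(spaceTime d)
      + c k * ∑ m ∈ s, ∫ z, ‖dx k φ z‖ * ‖w z.2 (M.cell h z.1 + m) - w z.2 (M.cell h z.1)‖
        ∂(spaceTime d)))
      ≤ entropyBalance φ η q (onSpaceTime M h w) := by
  obtain ⟨L, hL⟩ := exists_lipschitzWith_comp hη hC hw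
  obtain ⟨Bη, -, hBη⟩ := exists_bound_on_ball hη.continuous C
  choose Bq hBq0 hBq using fun k => exists_bound_on_ball (hq k) C
  have hwm : ∀ i, Measurable fun t => w t i := fun i => (hw i).continuous.measurable
  set U : Space d × ℝ → Phase N := onSpaceTime M h w with hU
  set a : Space d × ℝ → ℝ := fun z => deriv (fun s => η (w s (M.cell h z.1))) z.2 with ha
  have ham : Measurable a :=
    M.measurable_comp_cell (g := fun t i => deriv (fun s => η (w s i)) t) fun i => measurable_deriv _
  have haB : ∀ z, ‖a z‖ ≤ L := fun z => norm_deriv_le_of_lipschitz (hL _)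
  have hUm : Measurable U := M.measurable_comp_cell (g := fun t i => w t i) hwm
  have hUC : ∀ z, ‖U z‖ ≤ C := fun z => hC _ _
  have hφc := hφ.1.continuous
  have hIa : Integrable (fun z => φ z * a z) (spaceTime d) :=
    integrable_mul_of_bounded hφc hφ.2 ham haB
  have hIη : Integrable (fun z => dt φ z * η (U z)) (spaceTime d) :=
    integrable_mul_of_bounded hφ.continuous_dt hφ.hasCompactSupport_dt
      (hη.continuous.measurable.comp hUm) fun z => hBη _ (hUC z)
  have hIq : ∀ k, Integrable (fun z => dx k φ z * q k (U z)) (spaceTime d) := fun k =>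
    integrable_mul_of_bounded (hφ.continuous_dx k) (hφ.hasCompactSupport_dx k)
      ((hq k).measurable.comp hUm) fun z => hBq k _ (hUC z)
  have hJm : ∀ m, Measurable fun z : Space d × ℝ =>
      ‖w z.2 (M.cell h z.1 + m) - w z.2 (M.cell h z.1)‖ := fun m =>
    (M.measurable_comp_cell (g := fun t i => w t (i + m) - w t i)
      fun i => (hwm _).sub (hwm _)).norm
  have hJB : ∀ m (z : Space d × ℝ),
      ‖‖w z.2 (M.cell h z.1 + m) - w z.2 (M.cell h z.1)‖‖ ≤ C + C := fun m z => by
    rw [norm_norm]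
    exact (norm_sub_le _ _).trans (add_le_add (hC _ _) (hC _ _))
  have hIJ : ∀ k m, Integrable (fun z : Space d × ℝ =>
      ‖dx k φ z‖ * ‖w z.2 (M.cell h z.1 + m) - w z.2 (M.cell h z.1)‖) (spaceTime d) := fun k m =>
    integrable_mul_of_bounded (hφ.continuous_dx k).norm (hφ.hasCompactSupport_dx k).norm
      (hJm m) (hJB m)
  have hID : ∀ k, Integrable (fun z => ‖diffQuot k (M.width h k) φ z - dx k φ z‖)
      (spaceTime d) := fun k =>
    (((hφ.continuous_diffQuot k _).sub (hφ.continuous_dx k)).integrable_of_hasCompactSupport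
      ((hφ.hasCompactSupport_diffQuot k _).sub (hφ.hasCompactSupport_dx k))).norm
  -- the upper bound for the flux terms after replacing `G` by `q (w)` and difference quotients by
  -- derivatives
  set E : Fin d → Space d × ℝ → ℝ := fun k z => dx k φ z * q k (U z)
    + (B k * ‖diffQuot k (M.width h k) φ z - dx k φ z‖
      + c k * ∑ m ∈ s, ‖dx k φ z‖ * ‖w z.2 (M.cell h z.1 + m) - w z.2 (M.cell h z.1)‖) with hE
  have hIE2 : ∀ k, Integrable (fun z => B k * ‖diffQuot k (M.width h k) φ z - dx k φ z‖
      + c k * ∑ m ∈ s, ‖dx k φ z‖ * ‖w z.2 (M.cell h z.1 + m) - w z.2 (M.cell h z.1)‖)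
      (spaceTime d) := fun k =>
    ((hID k).const_mul _).add ((integrable_finsetSum _ fun m _ => hIJ k m).const_mul _)
  have hIE : ∀ k, Integrable (E k) (spaceTime d) := fun k => (hIq k).add (hIE2 k)
  have hflux : ∀ k t i x, M.cell h x = i → diffQuot k (M.width h k) φ (x, t) * G k t i
      ≤ E k (x, t) := by
    intro k t i x hx
    have h1 : diffQuot k (M.width h k) φ (x, t) * G k t i = dx k φ (x, t) * q k (w t i)
        + ((diffQuot k (M.width h k) φ (x, t) - dx k φ (x, t)) * G k t i
          + dx k φ (x, t) * (G k t i - q k (w t i))) := by ring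
    have h2 : (diffQuot k (M.width h k) φ (x, t) - dx k φ (x, t)) * G k t i
        ≤ B k * ‖diffQuot k (M.width h k) φ (x, t) - dx k φ (x, t)‖ := by
      refine (Real.le_norm_self _).trans ?_
      rw [norm_mul, mul_comm]
      gcongr
      exact hB k t i
    have h3 : dx k φ (x, t) * (G k t i - q k (w t i))
        ≤ c k * ∑ m ∈ s, ‖dx k φ (x, t)‖ * ‖w t (i + m) - w t i‖ := by
      refine (Real.le_norm_self _).trans ?_
      rw [norm_mul, ← Finset.mul_sum]
      calc _ ≤ ‖dx k φ (x, t)‖ * (c k * ∑ m ∈ s, ‖w t (i + m) - w t i‖) := by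
            gcongr
            exact hc k t i
        _ = _ := by ring
    subst hx
    rw [h1]
    exact add_le_add le_rfl (add_le_add h2 h3)
  -- integrating first in time
  have hleft : ∫ z, φ z * a z ∂(spaceTime d)
      = -(∫ x, φ (x, 0) * η (U (x, 0))) - ∫ z, dt φ z * η (U z) ∂(spaceTime d) := by
    have hIa' := hIa
    have hIη' := hIη
    rw [spaceTime_eq_prod] at hIa' hIη' ⊢
    rw [integral_prod _ hIa', integral_prod _ hIη', ← integral_neg, ← integral_sub]
    · refine integral_congr_ae (Eventually.of_forall fun x => ?_)
      have hslice : ContDiff ℝ 1 fun t => φ (x, t) := hφ.1.comp (contDiff_const.prodMk contDiff_id)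
      have hd : ∀ t, deriv (fun t => φ (x, t)) t = dt φ (x, t) := fun t => by
        have h1 : HasDerivAt (fun t : ℝ => (x, t)) ((0 : Space d), (1 : ℝ)) t :=
          (hasDerivAt_const t x).prodMk (hasDerivAt_id t)
        exact ((hφ.differentiable (x, t)).hasFDerivAt.comp_hasDerivAt t h1).deriv
      have := integral_Ioi_mul_deriv_of_lipschitz (hL (M.cell h x)) hslice
        (hasCompactSupport_space_slice hφ.2 x)
      simp only [hd] at this
      exact this
    · refine (integrable_mul_of_bounded (B := Bη) hφ.initial.1.continuous hφ.initial.2 ?_ ?_).neg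
      · exact hη.continuous.measurable.comp (hUm.comp (measurable_id.prodMk measurable_const))
      · exact fun x => hBη _ (hUC _)
    · exact hIη'.integral_prod_left
  -- integrating first in space
  have hright : ∫ z, φ z * a z ∂(spaceTime d) ≤ ∑ k, ∫ z, E k z ∂(spaceTime d) := by
    rw [← integral_finsetSum _ fun k _ => hIE k]
    have hIa' := hIa
    have hIE' : Integrable (fun z => ∑ k, E k z) (spaceTime d) :=
      integrable_finsetSum _ fun k _ => hIE k
    have hIEk := hIE
    rw [spaceTime_eq_prod] at hIa' hIE' hIEk ⊢
    rw [integral_prod_symm _ hIa', integral_prod_symm _ hIE']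
    refine integral_mono_ae hIa'.integral_prod_right hIE'.integral_prod_right ?_
    have hall : ∀ k, ∀ᵐ t ∂(volume.restrict (Ioi (0 : ℝ))), Integrable fun x => E k (x, t) :=
      fun k => (hIEk k).prod_left_ae
    filter_upwards [ae_all_iff.2 hent, ae_all_iff.2 hall, ae_restrict_mem measurableSet_Ioi]
      with t ht hEt ht0
    have h1 := integral_mul_le_sum_integral_diffQuot (M := M) (h := h) he
      (a := fun i => deriv (fun s => η (w s i)) t) (G := fun k i => G k t i) (A := L) (B := B)
      (fun i => norm_deriv_le_of_lipschitz (hL i)) (fun k i => hB k t i) ht hφ (t := t)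
      (fun x => hpos x t (le_of_lt ht0))
    refine h1.trans ?_
    rw [integral_finsetSum _ fun k _ => hEt k]
    refine Finset.sum_le_sum fun k _ => integral_mono ?_ (hEt k) fun x => hflux k t _ x rfl
    refine integrable_mul_of_bounded (B := B k) ((hφ.continuous_diffQuot k _).comp (by fun_prop))
      (hasCompactSupport_time_slice (hφ.hasCompactSupport_diffQuot k _) t) ?_ fun x => hB k t _
    exact (measurable_of_countable (G k t)).comp (M.measurable_cell h)
  have hEint : ∀ k, ∫ z, E k z ∂(spaceTime d) = ∫ z, dx k φ z * q k (U z) ∂(spaceTime d)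
      + (B k * ∫ z, ‖diffQuot k (M.width h k) φ z - dx k φ z‖ ∂(spaceTime d)
      + c k * ∑ m ∈ s, ∫ z, ‖dx k φ z‖ * ‖w z.2 (M.cell h z.1 + m) - w z.2 (M.cell h z.1)‖
        ∂(spaceTime d)) := by
    intro k
    rw [hE]
    simp only
    rw [integral_add (hIq k) (hIE2 k), integral_add ((hID k).const_mul _)
      ((integrable_finsetSum _ fun m _ => hIJ k m).const_mul _), integral_const_mul,
      integral_const_mul, integral_finsetSum _ fun m _ => hIJ k m]
  simp only [hEint, Finset.sum_add_distrib] at hright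
  rw [entropyBalance, integral_add hIη (integrable_finsetSum _ fun k _ => hIq k),
    integral_finsetSum _ fun k _ => hIq k, Finset.sum_add_distrib]
  linarith

/-- Along any weakly BV family of bounded approximate solutions that satisfies a discrete entropy
inequality, the weak entropy inequality holds up to an error that vanishes with the mesh size. -/
theorem eventually_neg_le_entropyBalance {u : ℝ → ℝ → Grid d → Phase N} {C : ℝ}
    (hC : ∀ h, 0 < h → ∀ t i, ‖u h t i‖ ≤ C)
    (hLip : ∀ h, 0 < h → ∃ K, ∀ i, LipschitzWith K fun t => u h t i) {r : ℝ} (hr : 1 ≤ r)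
    (hbv : ∀ T : ℝ, 0 < T → Tendsto (fun h => ∫⁻ t in Ioc 0 T, ∑' i : Grid d, ∑ k,
        ‖u h t (i + Pi.single k 1) - u h t i‖ₑ ^ r * ENNReal.ofReal (∏ l, M.width h l))
      (𝓝[>] 0) (𝓝 0))
    {η : Phase N → ℝ} (hη : LocallyLipschitz η) {q : Fin d → Phase N → ℝ}
    (hq : ∀ k, Continuous (q k)) {p : ℕ} {Q : Fin d → ℝ → (stencil d p → Phase N) → ℝ}
    (hQ : ∀ k, ConsistentFlux (Q k) (q k))
    (hent : ∀ h, 0 < h → ∀ i, ∀ᵐ t ∂(volume.restrict (Ioi (0 : ℝ))),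
      deriv (fun s => η (u h s i)) t + fluxDifference M h (fun k => Q k h) (u h t) i ≤ 0)
    {φ : Space d × ℝ → ℝ} (hφ : IsTest φ) (hpos : ∀ x t, 0 ≤ t → 0 ≤ φ (x, t))
    {δ : ℝ} (hδ : 0 < δ) :
    ∀ᶠ h in 𝓝[>] 0, -δ ≤ entropyBalance φ η q (onSpaceTime M h (u h)) := by
  choose c B hB0 hcB using fun k => (hQ k).exists_bound (hq k) C
  have hlim : Tendsto (fun h => ∑ k,
      (B k * ∫ z, ‖diffQuot k (M.width h k) φ z - dx k φ z‖ ∂(spaceTime d)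
      + c k * ∑ m ∈ stencil d p, ∫ z, ‖dx k φ z‖
        * ‖u h z.2 (M.cell h z.1 + m) - u h z.2 (M.cell h z.1)‖ ∂(spaceTime d)))
      (𝓝[>] 0) (𝓝 (∑ k : Fin d, (B k * 0
        + c k * ∑ m ∈ stencil d p, 0))) := by
    refine tendsto_finsetSum _ fun k _ => Tendsto.add ?_ ?_
    · exact (tendsto_integral_diffQuot_sub M hφ k).const_mul _
    · refine Tendsto.const_mul _ (tendsto_finsetSum _ fun m _ => ?_)
      refine tendsto_integral_jump (fun h hh i => ?_) hr hbv m (hφ.continuous_dx k)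
        (hφ.hasCompactSupport_dx k)
      obtain ⟨K, hK⟩ := hLip h hh
      exact (hK i).continuous
  simp only [mul_zero, Finset.sum_const_zero, add_zero] at hlim
  filter_upwards [hlim.eventually_lt_const hδ, self_mem_nhdsWithin] with h hlt hh
  have hh : 0 < h := hh
  obtain ⟨K, hK⟩ := hLip h hh
  refine le_trans (neg_le_neg hlt.le) ?_
  exact neg_error_le_entropyBalance (e := fun k => Pi.single k 1)
    (fun k x => M.cell_add_single hh k x) (hC h hh) hK hη hq
    (G := fun k t i => Q k h (atCell p (u h t) i)) (fun k t i => (hcB k h hh _ (hC h hh t) i).2)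
    (fun k t i => (hcB k h hh _ (hC h hh t) i).1) (fun i => hent h hh i) hφ hpos

end Deterministic

/-! ### Expectation over the realizations -/

section Random

variable {d N : ℕ} {M : Mesh d} {Ω : Type*} [MeasurableSpace Ω]

theorem integrable_prod_mul_of_bounded {D : Type*} [MeasurableSpace D] {μ : Measure D}
    [SFinite μ] {P : Measure Ω} [IsProbabilityMeasure P] {ψ : D → ℝ} (hψ : Integrable ψ μ)
    {b : D × Ω → ℝ} (hb : Measurable b) {B : ℝ} (hB : ∀ p, ‖b p‖ ≤ B) :
    Integrable (fun p : D × Ω => ψ p.1 * b p) (μ.prod P) :=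
  (hψ.comp_fst P).mul_bdd hb.aestronglyMeasurable (Eventually.of_forall hB)

theorem integrable_integral_mul {D : Type*} [MeasurableSpace D] {μ : Measure D}
    [SFinite μ] {P : Measure Ω} [IsProbabilityMeasure P] {ψ : D → ℝ} (hψ : Integrable ψ μ)
    {b : D × Ω → ℝ} (hb : Measurable b) {B : ℝ} (hB : ∀ p, ‖b p‖ ≤ B) :
    Integrable (fun ω => ∫ z, ψ z * b (z, ω) ∂μ) P :=
  (integrable_prod_mul_of_bounded hψ hb hB).integral_prod_right

theorem integral_integral_mul {D : Type*} [MeasurableSpace D] {μ : Measure D}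
    [SFinite μ] {P : Measure Ω} [IsProbabilityMeasure P] {ψ : D → ℝ} (hψ : Integrable ψ μ)
    {b : D × Ω → ℝ} (hb : Measurable b) {B : ℝ} (hB : ∀ p, ‖b p‖ ≤ B) :
    ∫ ω, ∫ z, ψ z * b (z, ω) ∂μ ∂P = ∫ z, ψ z * ∫ ω, b (z, ω) ∂P ∂μ := by
  have hi := integrable_prod_mul_of_bounded (P := P) hψ hb hB
  rw [← integral_prod_symm _ hi, integral_prod _ hi]
  simp only [integral_const_mul]

/-- A random grid function, bounded by `C`, that is Lipschitz continuous in time. -/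
structure IsBoundedField (C : ℝ) (u : Ω → ℝ → Grid d → Phase N) : Prop where
  bound : ∀ ω t i, ‖u ω t i‖ ≤ C
  lipschitz : ∃ K, ∀ ω i, LipschitzWith K fun t => u ω t i
  measurable : ∀ t i, Measurable fun ω => u ω t i

theorem IsBoundedField.measurable_onSpaceTime {C : ℝ} {u : Ω → ℝ → Grid d → Phase N}
    (hu : IsBoundedField C u) (h : ℝ) :
    Measurable fun p : (Space d × ℝ) × Ω => onSpaceTime M h (u p.2) p.1 := by
  have h1 : ∀ i, Measurable fun a : ℝ × Ω => u a.2 a.1 i := by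
    intro i
    obtain ⟨K, hK⟩ := hu.lipschitz
    exact measurable_uncurry_of_continuous_of_measurable (u := fun t ω => u ω t i)
      (fun ω => (hK ω i).continuous) fun t => hu.measurable t i
  have h2 := M.measurable_comp_cell (h := h) (g := fun (a : ℝ × Ω) i => u a.2 a.1 i) h1
  exact h2.comp ((measurable_fst.comp measurable_fst).prodMk
    ((measurable_snd.comp measurable_fst).prodMk measurable_snd))

theorem IsBoundedField.measurable_onSpace {C : ℝ} {u : Ω → ℝ → Grid d → Phase N}
    (hu : IsBoundedField C u) (h : ℝ) :
    Measurable fun p : Space d × Ω => onSpace M h (u p.2 0) p.1 :=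
  (hu.measurable_onSpaceTime (M := M) h).comp
    ((measurable_fst.prodMk measurable_const).prodMk measurable_snd)

/-- The law of a bounded random grid function as a coupling on space-time and the phase ball. -/
noncomputable def IsBoundedField.coupling {C : ℝ} {u : Ω → ℝ → Grid d → Phase N}
    (hu : IsBoundedField C u) (M : Mesh d) (h : ℝ) (P : Measure Ω) [IsProbabilityMeasure P] :
    ProbabilityMeasure ((Space d × ℝ) × Metric.closedBall (0 : Phase N) C) :=
  fieldCoupling (spaceTime d) P
    (fun p => ⟨onSpaceTime M h (u p.2) p.1, mem_closedBall_zero_iff.2 (hu.bound _ _ _)⟩)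
    ((hu.measurable_onSpaceTime h).subtype_mk)

theorem IsBoundedField.coupling_mem {C : ℝ} {u : Ω → ℝ → Grid d → Phase N}
    (hu : IsBoundedField C u) (M : Mesh d) (h : ℝ) (P : Measure Ω) [IsProbabilityMeasure P] :
    hu.coupling M h P ∈ couplings _ (spaceTime d).toFinite :=
  fieldCoupling_mem _ _ _ _

theorem IsBoundedField.couplingPairing_coupling {C : ℝ} {u : Ω → ℝ → Grid d → Phase N}
    (hu : IsBoundedField C u) (M : Mesh d) (h : ℝ) (P : Measure Ω) [IsProbabilityMeasure P]
    {φ : Space d × ℝ → ℝ} (hφ : Integrable φ (spaceTime d)) {g : Phase N → ℝ}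
    (hg : Continuous g) :
    couplingPairing (spaceTime d) φ (fun y : Metric.closedBall (0 : Phase N) C => g y)
        (hu.coupling M h P)
      = ∫ z, φ z * ∫ ω, g (onSpaceTime M h (u ω) z) ∂P ∂(spaceTime d) :=
  couplingPairing_fieldCoupling P _ _ hφ (hg.comp continuous_subtype_val)

/-- The space-time part of the weak entropy inequality, as a function of the coupling. -/
noncomputable def entropyProduction {C : ℝ} (φ : Space d × ℝ → ℝ) (η : Phase N → ℝ)
    (q : Fin d → Phase N → ℝ)
    (μ : ProbabilityMeasure ((Space d × ℝ) × Metric.closedBall (0 : Phase N) C)) : ℝ :=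
  couplingPairing (spaceTime d) (dt φ) (fun y : Metric.closedBall (0 : Phase N) C => η y) μ
    + ∑ k, couplingPairing (spaceTime d) (dx k φ)
        (fun y : Metric.closedBall (0 : Phase N) C => q k y) μ

theorem tendsto_entropyProduction {C : ℝ} {ι : Type*} {l : Filter ι}
    {μs : ι → ProbabilityMeasure ((Space d × ℝ) × Metric.closedBall (0 : Phase N) C)}
    {μ : ProbabilityMeasure ((Space d × ℝ) × Metric.closedBall (0 : Phase N) C)}
    (hμs : ∀ᶠ i in l, μs i ∈ couplings _ (spaceTime d).toFinite)
    (hμ : μ ∈ couplings _ (spaceTime d).toFinite) (hlim : Tendsto μs l (𝓝 μ))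
    {φ : Space d × ℝ → ℝ} (hφ : IsTest φ) {η : Phase N → ℝ} (hη : Continuous η)
    {q : Fin d → Phase N → ℝ} (hq : ∀ k, Continuous (q k)) :
    Tendsto (fun i => entropyProduction φ η q (μs i)) l
      (𝓝 (entropyProduction φ η q μ)) := by
  refine Tendsto.add ?_ (tendsto_finsetSum _ fun k _ => ?_)
  · exact tendsto_couplingPairing hμs hμ hlim hφ.integrable_dt (hη.comp continuous_subtype_val)
  · exact tendsto_couplingPairing hμs hμ hlim (hφ.integrable_dx k)
      ((hq k).comp continuous_subtype_val)

/-- The mean of the entropy balance is the entropy production of the coupling plus the pairing of the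
initial law, by Fubini's theorem. -/
theorem IsBoundedField.integrable_entropyBalance {C h : ℝ} {u : Ω → ℝ → Grid d → Phase N}
    (hu : IsBoundedField C u) (P : Measure Ω) [IsProbabilityMeasure P] {φ : Space d × ℝ → ℝ}
    (hφ : IsTest φ) {η : Phase N → ℝ} (hη : Continuous η) {q : Fin d → Phase N → ℝ}
    (hq : ∀ k, Continuous (q k)) :
    Integrable (fun ω => entropyBalance φ η q (onSpaceTime M h (u ω))) P ∧
    ∫ ω, entropyBalance φ η q (onSpaceTime M h (u ω)) ∂P
      = entropyProduction φ η q (hu.coupling M h P)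
        + ∫ x, φ (x, 0) * ∫ ω, η (onSpace M h (u ω 0) x) ∂P := by
  obtain ⟨Bη, -, hBη⟩ := exists_bound_on_ball hη C
  choose Bq hBq0 hBq using fun k => exists_bound_on_ball (hq k) C
  have hU := hu.measurable_onSpaceTime (M := M) h
  have hU0 := hu.measurable_onSpace (M := M) h
  have hdt := hφ.integrable_dt
  have hdx := hφ.integrable_dx
  have hφ0 : Integrable (fun x : Space d => φ (x, 0)) :=
    hφ.initial.1.continuous.integrable_of_hasCompactSupport hφ.initial.2
  have i1 := integrable_integral_mul (P := P) hdt (hη.measurable.comp hU)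
    (B := Bη) (fun p => hBη _ (hu.bound _ _ _))
  have i2 := fun k => integrable_integral_mul (P := P) (hdx k) ((hq k).measurable.comp hU)
    (B := Bq k) (fun p => hBq k _ (hu.bound _ _ _))
  have i3 := integrable_integral_mul (P := P) hφ0 (hη.measurable.comp hU0)
    (B := Bη) (fun p => hBη _ (hu.bound _ _ _))
  simp only [Function.comp_apply] at i1 i2 i3
  have hUω : ∀ ω, Measurable (onSpaceTime M h (u ω)) := fun ω =>
    hU.comp (measurable_id.prodMk measurable_const)
  have hsplit : ∀ ω, entropyBalance φ η q (onSpaceTime M h (u ω)) =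
      (∫ z, dt φ z * η (onSpaceTime M h (u ω) z) ∂(spaceTime d)
        + ∑ k, ∫ z, dx k φ z * q k (onSpaceTime M h (u ω) z) ∂(spaceTime d))
      + ∫ x, φ (x, 0) * η (onSpace M h (u ω 0) x) := by
    intro ω
    have j1 : Integrable (fun z => dt φ z * η (onSpaceTime M h (u ω) z)) (spaceTime d) :=
      hdt.mul_bdd (hη.measurable.comp (hUω ω)).aestronglyMeasurable
        (Eventually.of_forall fun z => hBη _ (hu.bound _ _ _))
    have j2 : ∀ k, Integrable (fun z => dx k φ z * q k (onSpaceTime M h (u ω) z))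
        (spaceTime d) := fun k =>
      (hdx k).mul_bdd ((hq k).measurable.comp (hUω ω)).aestronglyMeasurable
        (Eventually.of_forall fun z => hBq k _ (hu.bound _ _ _))
    rw [entropyBalance, integral_add j1 (integrable_finsetSum _ fun k _ => j2 k),
      integral_finsetSum _ fun k _ => j2 k]
    rfl
  simp only [hsplit]
  have i2' := integrable_finsetSum Finset.univ fun k _ => i2 k
  refine ⟨(i1.add i2').add i3, ?_⟩
  rw [integral_add (by exact i1.add i2') i3, integral_add i1 i2', integral_finsetSum _ fun k _ => i2 k]
  have e1 := integral_integral_mul (P := P) hdt (hη.measurable.comp hU)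
    (B := Bη) (fun p => hBη _ (hu.bound _ _ _))
  have e2 := fun k => integral_integral_mul (P := P) (hdx k) ((hq k).measurable.comp hU)
    (B := Bq k) (fun p => hBq k _ (hu.bound _ _ _))
  have e3 := integral_integral_mul (P := P) hφ0 (hη.measurable.comp hU0)
    (B := Bη) (fun p => hBη _ (hu.bound _ _ _))
  simp only [Function.comp_apply] at e1 e2 e3
  rw [e1, e3, entropyProduction, hu.couplingPairing_coupling M h P hdt hη]
  congr 2
  refine Finset.sum_congr rfl fun k _ => ?_
  rw [e2 k, hu.couplingPairing_coupling M h P (hdx k) (hq k)]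

theorem exists_abs_entropyBalance_le (C : ℝ) {φ : Space d × ℝ → ℝ} (hφ : IsTest φ)
    {η : Phase N → ℝ} (hη : Continuous η) {q : Fin d → Phase N → ℝ}
    (hq : ∀ k, Continuous (q k)) :
    ∃ A, ∀ U : Space d × ℝ → Phase N, (∀ z, ‖U z‖ ≤ C) → |entropyBalance φ η q U| ≤ A := by
  obtain ⟨Bη, -, hBη⟩ := exists_bound_on_ball hη C
  choose Bq hBq0 hBq using fun k => exists_bound_on_ball (hq k) C
  have hdt := hφ.integrable_dt
  have hdx := hφ.integrable_dx
  have hφ0 : Integrable (fun x : Space d => φ (x, 0)) :=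
    hφ.initial.1.continuous.integrable_of_hasCompactSupport hφ.initial.2
  refine ⟨(∫ z, (‖dt φ z‖ * Bη + ∑ k, ‖dx k φ z‖ * Bq k) ∂(spaceTime d))
    + ∫ x, ‖φ (x, 0)‖ * Bη, fun U hU => ?_⟩
  rw [entropyBalance, ← Real.norm_eq_abs]
  refine (norm_add_le _ _).trans (add_le_add ?_ ?_)
  · refine norm_integral_le_of_norm_le ((hdt.norm.mul_const _).add
      (integrable_finsetSum _ fun k _ => (hdx k).norm.mul_const _))
      (Eventually.of_forall fun z => ?_)
    refine (norm_add_le _ _).trans (add_le_add ?_ ((norm_sum_le _ _).trans ?_))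
    · rw [norm_mul]
      exact mul_le_mul_of_nonneg_left (hBη _ (hU z)) (norm_nonneg _)
    · refine Finset.sum_le_sum fun k _ => ?_
      rw [norm_mul]
      exact mul_le_mul_of_nonneg_left (hBq k _ (hU z)) (norm_nonneg _)
  · refine norm_integral_le_of_norm_le (hφ0.norm.mul_const _) (Eventually.of_forall fun x => ?_)
    rw [norm_mul]
    exact mul_le_mul_of_nonneg_left (hBη _ (hU _)) (norm_nonneg _)

/-- The error in the entropy inequality vanishes for every realization; dominated convergence for
the negative part makes it vanish in mean. -/
theorem eventually_neg_le_integral_entropyBalance {P : Measure Ω} [IsProbabilityMeasure P]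
    {u : ℝ → Ω → ℝ → Grid d → Phase N} {C : ℝ} (hu : ∀ h, 0 < h → IsBoundedField C (u h))
    (hbv : WeakBV M u) {η : Phase N → ℝ} (hη : LocallyLipschitz η) {q : Fin d → Phase N → ℝ}
    (hq : ∀ k, Continuous (q k)) (hent : EntropyConsistent M η q u)
    {φ : Space d × ℝ → ℝ} (hφ : IsTest φ) (hpos : ∀ x t, 0 ≤ t → 0 ≤ φ (x, t))
    {δ : ℝ} (hδ : 0 < δ) :
    ∀ᶠ h in 𝓝[>] 0, -δ ≤ ∫ ω, entropyBalance φ η q (onSpaceTime M h (u h ω)) ∂P := by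
  obtain ⟨r, hr, hbv⟩ := hbv
  obtain ⟨p, -, Q, hQ, hent⟩ := hent
  obtain ⟨A, hA⟩ := exists_abs_entropyBalance_le C hφ hη.continuous hq
  have hA' : ∀ h, 0 < h → ∀ ω, |entropyBalance φ η q (onSpaceTime M h (u h ω))| ≤ A :=
    fun h hh ω => hA _ fun z => (hu h hh).bound _ _ _
  have hint : ∀ h, 0 < h →
      Integrable (fun ω => entropyBalance φ η q (onSpaceTime M h (u h ω))) P := fun h hh =>
    ((hu h hh).integrable_entropyBalance P hφ hη.continuous hq).1
  have hlim : Tendsto (fun h => ∫ ω, min (entropyBalance φ η q (onSpaceTime M h (u h ω))) 0 ∂P)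
      (𝓝[>] 0) (𝓝 (∫ _ω, (0 : ℝ) ∂P)) := by
    refine tendsto_integral_filter_of_dominated_convergence (fun _ => A) ?_ ?_
      (integrable_const _) ?_
    · filter_upwards [self_mem_nhdsWithin] with h hh
      exact (hint h hh).aestronglyMeasurable.inf aestronglyMeasurable_const
    · filter_upwards [self_mem_nhdsWithin] with h hh
      refine Eventually.of_forall fun ω => ?_
      have h1 := abs_le.1 (hA' h hh ω)
      rw [Real.norm_eq_abs, abs_le]
      exact ⟨le_min h1.1 (by linarith [h1.1, h1.2]), (min_le_right _ _).trans (by linarith [h1.1, h1.2])⟩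
    · refine Eventually.of_forall fun ω => ?_
      rw [Metric.tendsto_nhds]
      intro ε hε
      filter_upwards [eventually_neg_le_entropyBalance (u := fun h => u h ω)
        (fun h hh => (hu h hh).bound ω)
        (fun h hh => (hu h hh).lipschitz.imp fun K hK => hK ω) hr (hbv ω) hη hq hQ
        (fun h hh => hent h hh ω) hφ hpos (half_pos hε)] with h hh
      rw [Real.dist_eq, sub_zero, abs_lt]
      refine ⟨?_, ?_⟩
      · have := le_min hh (by linarith : -(ε / 2) ≤ 0)
        linarith
      · exact (min_le_right _ _).trans_lt hε
  rw [integral_zero] at hlim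
  filter_upwards [hlim.eventually_const_lt (neg_lt_zero.2 hδ), self_mem_nhdsWithin] with h hh hpos'
  refine hh.le.trans (integral_mono ((hint h hpos').inf (integrable_const _)) (hint h hpos') ?_)
  exact fun ω => min_le_left _ _

theorem integral_law {D : Type*} {P : Measure Ω} {U : Ω → D → Phase N} {z : D}
    (hU : Measurable fun ω => U ω z) {V : Type*} [NormedAddCommGroup V] [NormedSpace ℝ V]
    {g : Phase N → V} (hg : Continuous g) :
    ∫ ξ, g ξ ∂(law P U z) = ∫ ω, g (U ω z) ∂P :=
  integral_map hU.aemeasurable hg.aestronglyMeasurable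

/-- Passage to the limit of vanishing mesh size for a fixed random initial datum. -/
theorem entropyProduction_add_nonneg {P : Measure Ω} [IsProbabilityMeasure P]
    {u : ℝ → Ω → ℝ → Grid d → Phase N} {C : ℝ} (hu : ∀ h, 0 < h → IsBoundedField C (u h))
    (hbv : WeakBV M u) {η : Phase N → ℝ} (hη : LocallyLipschitz η) {q : Fin d → Phase N → ℝ}
    (hq : ∀ k, Continuous (q k)) (hent : EntropyConsistent M η q u)
    {σ : Space d → Measure (Phase N)}
    (hσ : EntropyMeanConsistent η (fun h => law P fun ω => onSpace M h (u h ω 0)) σ)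
    {h : ℕ → ℝ} (hh : ∀ n, 0 < h n) (hlim : Tendsto h atTop (𝓝 0))
    {μ : ProbabilityMeasure ((Space d × ℝ) × Metric.closedBall (0 : Phase N) C)}
    (hμ : μ ∈ couplings _ (spaceTime d).toFinite)
    (hμlim : Tendsto (fun n => (hu (h n) (hh n)).coupling M (h n) P) atTop (𝓝 μ))
    {φ : Space d × ℝ → ℝ} (hφ : IsTest φ) (hpos : ∀ x t, 0 ≤ t → 0 ≤ φ (x, t)) :
    0 ≤ entropyProduction φ η q μ + ∫ x, φ (x, 0) * ∫ ξ, η ξ ∂(σ x) := by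
  have hlim' : Tendsto h atTop (𝓝[>] 0) :=
    tendsto_nhdsWithin_iff.2 ⟨hlim, Eventually.of_forall hh⟩
  have hE := tendsto_entropyProduction
    (Eventually.of_forall fun n => (hu (h n) (hh n)).coupling_mem M (h n) P) hμ hμlim hφ
    hη.continuous hq
  refine le_of_forall_pos_le_add fun δ hδ => ?_
  have h1 := eventually_neg_le_integral_entropyBalance (P := P) hu hbv hη hq hent hφ hpos
    (half_pos hδ)
  have h2 : ∀ᶠ h in 𝓝[>] 0, ∫ x, φ (x, 0) * ∫ ξ, η ξ ∂(law P (fun ω => onSpace M h (u h ω 0)) x)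
      < (∫ x, φ (x, 0) * ∫ ξ, η ξ ∂(σ x)) + δ / 2 := by
    have h3 := hσ.2 (fun x => φ (x, 0)) hφ.initial fun x => hpos x 0 le_rfl
    have h4 : ((∫ x, φ (x, 0) * ∫ ξ, η ξ ∂(σ x) : ℝ) : EReal)
        < (((∫ x, φ (x, 0) * ∫ ξ, η ξ ∂(σ x)) + δ / 2 : ℝ) : EReal) :=
      EReal.coe_lt_coe_iff.2 (by linarith)
    filter_upwards [eventually_lt_of_limsup_lt (h3.trans_lt h4)] with h hh
    exact EReal.coe_lt_coe_iff.1 hh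
  have h3 : ∀ᶠ n in atTop, -(δ / 2) - ((∫ x, φ (x, 0) * ∫ ξ, η ξ ∂(σ x)) + δ / 2)
      ≤ entropyProduction φ η q ((hu (h n) (hh n)).coupling M (h n) P) := by
    filter_upwards [hlim'.eventually h1, hlim'.eventually h2] with n hn1 hn2
    rw [((hu (h n) (hh n)).integrable_entropyBalance P hφ hη.continuous hq).2] at hn1
    have h4 : ∀ x, ∫ ξ, η ξ ∂(law P (fun ω => onSpace M (h n) (u (h n) ω 0)) x)
        = ∫ ω, η (onSpace M (h n) (u (h n) ω 0) x) ∂P := fun x =>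
      integral_law (U := fun ω => onSpace M (h n) (u (h n) ω 0))
        (((hu (h n) (hh n)).measurable_onSpace (M := M) (h n)).comp measurable_prodMk_left)
        hη.continuous
    simp only [h4] at hn2
    linarith
  have := ge_of_tendsto hE h3
  linarith

end Random

/-! ### Solutions of the semi-discrete scheme -/

section SchemeSolutions

variable {d N p : ℕ} {M : Mesh d} {Ω : Type*} [MeasurableSpace Ω]

/-- A bounded solution of the scheme is Lipschitz continuous in time, with a constant that depends
on the mesh size but not on the solution. -/
theorem exists_lipschitzWith_scheme {F : Fin d → ℝ → (stencil d p → Phase N) → Phase N}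
    {f : Fin d → Phase N → Phase N} (hF : ∀ k, ConsistentFlux (F k) (f k))
    (hf : ∀ k, Continuous (f k)) (C : ℝ) {h : ℝ} (hh : 0 < h) :
    ∃ K : NNReal, ∀ (u₀ : Grid d → Phase N) (u : ℝ → Grid d → Phase N),
      IsSchemeSolution M h (fun k => F k h) u₀ u → (∀ t, 0 ≤ t → ∀ i, ‖u t i‖ ≤ C) →
        ∀ i, LipschitzWith K fun t => u (max t 0) i := by
  choose c B hB0 hcB using fun k => (hF k).exists_bound (hf k) C
  have hL0 : 0 ≤ ∑ k, (M.width h k)⁻¹ * (B k + B k) :=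
    Finset.sum_nonneg fun k _ =>
      mul_nonneg (inv_nonneg.2 (M.width_pos hh k).le) (add_nonneg (hB0 k) (hB0 k))
  refine ⟨⟨_, hL0⟩, fun u₀ u hu huC i => ?_⟩
  have hflux : ∀ t, 0 ≤ t → ‖fluxDifference M h (fun k => F k h) (u t) i‖
      ≤ ∑ k, (M.width h k)⁻¹ * (B k + B k) := by
    intro t ht
    refine (norm_sum_le _ _).trans (Finset.sum_le_sum fun k _ => ?_)
    rw [norm_smul, norm_inv, Real.norm_of_nonneg (M.width_pos hh k).le]
    refine mul_le_mul_of_nonneg_left ?_ (inv_nonneg.2 (M.width_pos hh k).le)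
    exact (norm_sub_le _ _).trans
      (add_le_add (hcB k h hh _ (huC t ht) _).2 (hcB k h hh _ (huC t ht) _).2)
  have key : ∀ s t, 0 ≤ s → s ≤ t →
      dist (u t i) (u s i) ≤ (∑ k, (M.width h k)⁻¹ * (B k + B k)) * |t - s| := by
    intro s t hs hst
    rw [dist_eq_norm, hu.evolution i s t hs hst, sub_sub_cancel_left, norm_neg]
    refine intervalIntegral.norm_integral_le_of_norm_le_const fun τ hτ => hflux τ ?_
    rw [uIoc_of_le hst] at hτ
    exact hs.trans hτ.1.le
  refine LipschitzWith.of_dist_le_mul fun t s => ?_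
  have hmax : |max t 0 - max s 0| ≤ |t - s| := by
    have := abs_max_sub_max_le_max t 0 s 0
    simpa using this
  rw [Real.dist_eq]
  rcases le_total (max s 0) (max t 0) with hst | hst
  · exact (key _ _ (le_max_right _ _) hst).trans (mul_le_mul_of_nonneg_left hmax hL0)
  · rw [dist_comm]
    refine (key _ _ (le_max_right _ _) hst).trans ?_
    rw [abs_sub_comm]
    exact mul_le_mul_of_nonneg_left hmax hL0

theorem isBoundedField_scheme {F : Fin d → ℝ → (stencil d p → Phase N) → Phase N}
    {f : Fin d → Phase N → Phase N} (hF : ∀ k, ConsistentFlux (F k) (f k))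
    (hf : ∀ k, Continuous (f k)) {C h : ℝ} (hh : 0 < h) {u₀ : Ω → Grid d → Phase N}
    {u : Ω → ℝ → Grid d → Phase N}
    (hu : ∀ ω, IsSchemeSolution M h (fun k => F k h) (u₀ ω) (u ω))
    (hmeas : ∀ t, 0 ≤ t → ∀ i, Measurable fun ω => u ω t i)
    (hC : ∀ ω t, 0 ≤ t → ∀ i, ‖u ω t i‖ ≤ C) :
    IsBoundedField C fun ω t => u ω (max t 0) where
  bound ω t i := hC ω _ (le_max_right _ _) i
  lipschitz := by
    obtain ⟨K, hK⟩ := exists_lipschitzWith_scheme (M := M) hF hf C hh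
    exact ⟨K, fun ω i => hK _ _ (hu ω) (hC ω) i⟩
  measurable t i := hmeas _ (le_max_right _ _) i

theorem WeakBV.comp_max {u : ℝ → Ω → ℝ → Grid d → Phase N} (hu : WeakBV M u) :
    WeakBV M fun h ω t => u h ω (max t 0) := by
  obtain ⟨r, hr, hlim⟩ := hu
  refine ⟨r, hr, fun ω T hT => (hlim ω T hT).congr fun h => ?_⟩
  refine setLIntegral_congr_fun measurableSet_Ioc fun t ht => ?_
  simp only [max_eq_left ht.1.le]

theorem EntropyConsistent.comp_max {u : ℝ → Ω → ℝ → Grid d → Phase N} {η : Phase N → ℝ}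
    {q : Fin d → Phase N → ℝ} (hu : EntropyConsistent M η q u) :
    EntropyConsistent M η q fun h ω t => u h ω (max t 0) := by
  obtain ⟨p, hp, Q, hQ, hent⟩ := hu
  refine ⟨p, hp, Q, hQ, fun h hh ω i => ?_⟩
  filter_upwards [hent h hh ω i, ae_restrict_mem measurableSet_Ioi] with t ht ht0
  have ht0 : 0 < t := ht0
  have h1 : (fun s => η (u h ω (max s 0) i)) =ᶠ[𝓝 t] fun s => η (u h ω s i) := by
    filter_upwards [eventually_gt_nhds ht0] with s hs
    rw [max_eq_left hs.le]
  rw [h1.deriv_eq, max_eq_left ht0.le]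
  exact ht

/-- Linear functionals are entropies for which the scheme itself is the entropy inequality, with
equality. -/
theorem entropyConsistent_linear {F : Fin d → ℝ → (stencil d p → Phase N) → Phase N}
    {f : Fin d → Phase N → Phase N} (hp : 1 ≤ p) (hF : ∀ k, ConsistentFlux (F k) (f k))
    {u₀ : ℝ → Ω → Grid d → Phase N} {u : ℝ → Ω → ℝ → Grid d → Phase N}
    (hu : ∀ h, 0 < h → ∀ ω, IsSchemeSolution M h (fun k => F k h) (u₀ h ω) (u h ω))
    (ℓ : Phase N →L[ℝ] ℝ) :
    EntropyConsistent M ℓ (fun k ξ => ℓ (f k ξ)) u := by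
  refine ⟨p, hp, fun k h w => ℓ (F k h w), fun k K hK => ?_, fun h hh ω i => ?_⟩
  · obtain ⟨c, hc0, hc⟩ := hF k K hK
    refine ⟨(‖ℓ‖ + 1) * c, by positivity, fun h hh w hw => ?_⟩
    rw [← map_sub]
    refine (ℓ.le_opNorm _).trans ?_
    rw [mul_assoc]
    exact mul_le_mul (by linarith) (hc h hh w hw) (norm_nonneg _) (by positivity)
  · have hsol := hu h hh ω
    have hae : ∀ n : ℕ, ∀ᵐ t, t ∈ uIcc 0 (n : ℝ) → ∀ c ∈ uIcc 0 (n : ℝ),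
        HasDerivAt (fun x => ∫ τ in c..x, fluxDifference M h (fun k => F k h) (u h ω τ) i)
          (fluxDifference M h (fun k => F k h) (u h ω t) i) t := fun n =>
      (hsol.integrable i 0 n le_rfl (Nat.cast_nonneg n)).ae_hasDerivAt_integral
    filter_upwards [ae_restrict_of_ae (ae_all_iff.2 hae), ae_restrict_mem measurableSet_Ioi]
      with t ht ht0
    have ht0 : 0 < t := ht0
    obtain ⟨n, hn⟩ := exists_nat_gt t
    have h1 := ht n (by rw [uIcc_of_le (Nat.cast_nonneg n)]; exact ⟨ht0.le, hn.le⟩) 0 left_mem_uIcc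
    have h2 : HasDerivAt (fun s => u h ω s i)
        (-fluxDifference M h (fun k => F k h) (u h ω t) i) t := by
      have h3 := h1.const_sub (u h ω 0 i)
      refine h3.congr_of_eventuallyEq ?_
      filter_upwards [eventually_gt_nhds ht0] with s hs
      exact hsol.evolution i 0 s le_rfl hs.le
    have h4 : HasDerivAt (fun s => ℓ (u h ω s i))
        (ℓ (-fluxDifference M h (fun k => F k h) (u h ω t) i)) t :=
      ℓ.hasFDerivAt.comp_hasDerivAt t h2
    rw [h4.deriv]
    have h5 : ℓ (fluxDifference M h (fun k => F k h) (u h ω t) i)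
        = fluxDifference M h (fun k w => ℓ (F k h w)) (u h ω t) i := by
      simp only [fluxDifference, map_sum, map_smul, map_sub]
    rw [map_neg, h5, neg_add_cancel]

end SchemeSolutions

/-! ### Laws of random initial data -/

section InitialData

variable {d N : ℕ} {Ω : Type*} [MeasurableSpace Ω] {P : Measure Ω} [IsProbabilityMeasure P]

theorem IsSpatialTest.integrable {ψ : Space d → ℝ} (hψ : IsSpatialTest ψ) :
    Integrable ψ :=
  hψ.1.continuous.integrable_of_hasCompactSupport hψ.2

theorem integral_mul_linear_law {U : Ω → Space d → Phase N}
    (hU : Measurable fun p : Space d × Ω => U p.2 p.1) {ψ : Space d → ℝ}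
    (hI : Integrable (fun p : Space d × Ω => ψ p.1 • U p.2 p.1) (volume.prod P))
    (ℓ : Phase N →L[ℝ] ℝ) :
    ∫ x, ψ x * ∫ ξ, ℓ ξ ∂(law P U x) = ℓ (∫ x, ψ x • ∫ ξ, ξ ∂(law P U x)) := by
  have hUx : ∀ x, Measurable fun ω => U ω x := fun x => hU.comp measurable_prodMk_left
  have h1 : ∀ x, ψ x * ∫ ξ, ℓ ξ ∂(law P U x) = ∫ ω, ℓ (ψ x • U ω x) ∂P := fun x => by
    rw [integral_law (hUx x) ℓ.continuous, ← integral_const_mul]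
    simp only [map_smul, smul_eq_mul]
  have h2 : ∀ x, ψ x • ∫ ξ, ξ ∂(law P U x) = ∫ ω, ψ x • U ω x ∂P := fun x => by
    rw [integral_law (hUx x) continuous_id', integral_smul]
  simp only [h1, h2]
  rw [← integral_prod _ hI, ← ℓ.integral_comp_comm hI, integral_prod _ (ℓ.integrable_comp hI)]

section Perturbation

variable {u₀ : Space d → Phase N} {X : Ω → Space d → Phase N}

theorem measurable_perturbation (hu₀ : Measurable u₀) (hX : Measurable (Function.uncurry X))
    (ε : ℝ) : Measurable fun p : Space d × Ω => u₀ p.1 + ε • X p.2 p.1 :=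
  (hu₀.comp measurable_fst).add ((hX.comp measurable_swap).const_smul ε)

theorem integrable_field_of_eLpNorm_le (hX : Measurable (Function.uncurry X))
    (hX_norm : ∀ᵐ ω ∂P, eLpNorm (X ω) 1 volume ≤ 1) :
    Integrable (fun p : Space d × Ω => X p.2 p.1) (volume.prod P) := by
  have hXm : Measurable fun p : Space d × Ω => X p.2 p.1 := hX.comp measurable_swap
  refine ⟨hXm.aestronglyMeasurable, ?_⟩
  rw [HasFiniteIntegral, lintegral_prod_symm _ hXm.enorm.aemeasurable]
  refine lt_of_le_of_lt (lintegral_mono_ae (g := fun _ => 1) ?_) (by simp)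
  filter_upwards [hX_norm] with ω hω
  rwa [eLpNorm_one_eq_lintegral_enorm] at hω

theorem integrable_perturbation (hu₀_one : MemLp u₀ 1 volume)
    (hX : Integrable (fun p : Space d × Ω => X p.2 p.1) (volume.prod P)) (ε : ℝ) :
    Integrable (fun p : Space d × Ω => u₀ p.1 + ε • X p.2 p.1) (volume.prod P) :=
  ((memLp_one_iff_integrable.1 hu₀_one).comp_fst P).add (hX.smul ε)

end Perturbation

theorem integrable_test_smul {ψ : Space d → ℝ} (hψ : IsSpatialTest ψ)
    {U : Space d × Ω → Phase N} (hU : Integrable U (volume.prod P)) :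
    Integrable (fun p : Space d × Ω => ψ p.1 • U p) (volume.prod P) := by
  obtain ⟨B, hB⟩ := hψ.2.exists_bound_of_continuous hψ.1.continuous
  exact hU.bdd_smul B (hψ.1.continuous.measurable.comp measurable_fst).aestronglyMeasurable
    (Eventually.of_forall fun p : Space d × Ω => hB p.1)

/-- For a linear entropy, consistency of the means is consistency with respect to the entropy. -/
theorem entropyMeanConsistent_linear {M : Mesh d} {C : ℝ} {v : ℝ → Ω → Grid d → Phase N}
    (hv : ∀ h, 0 < h → Measurable fun p : Space d × Ω => onSpace M h (v h p.2) p.1)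
    (hC : ∀ h, 0 < h → ∀ ω i, ‖v h ω i‖ ≤ C) {U : Ω → Space d → Phase N}
    (hU : Measurable fun p : Space d × Ω => U p.2 p.1)
    (hUi : Integrable (fun p : Space d × Ω => U p.2 p.1) (volume.prod P))
    (hmean : MeanConsistent (fun h => law P fun ω => onSpace M h (v h ω)) (law P U))
    (ℓ : Phase N →L[ℝ] ℝ) :
    EntropyMeanConsistent ℓ (fun h => law P fun ω => onSpace M h (v h ω)) (law P U) := by
  have hUx : ∀ x, Measurable fun ω => U ω x := fun x => hU.comp measurable_prodMk_left
  refine ⟨⟨?_, ?_⟩, fun ψ hψ _ => ?_⟩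
  · filter_upwards [(ℓ.integrable_comp hUi).prod_right_ae] with x hx
    exact (integrable_map_measure ℓ.continuous.aestronglyMeasurable (hUx x).aemeasurable).2 hx
  · have h1 : (fun x => ∫ ξ, ‖ℓ ξ‖ ∂(law P U x)) = fun x => ∫ ω, ‖ℓ (U ω x)‖ ∂P := by
      ext x
      exact integral_law (hUx x) ℓ.continuous.norm
    rw [h1]
    exact ((ℓ.integrable_comp hUi).integral_norm_prod_left).locallyIntegrable
  · have h1 := (ℓ.continuous.tendsto _).comp (hmean ψ hψ)
    have h2 : Tendsto (fun h => ((∫ x, ψ x * ∫ ξ, ℓ ξ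
        ∂(law P (fun ω => onSpace M h (v h ω)) x) : ℝ) : EReal)) (𝓝[>] 0)
        (𝓝 ((∫ x, ψ x * ∫ ξ, ℓ ξ ∂(law P U x) : ℝ) : EReal)) := by
      refine (continuous_coe_real_ereal.tendsto _).comp ?_
      rw [integral_mul_linear_law hU (integrable_test_smul hψ hUi)]
      refine h1.congr' ?_
      filter_upwards [self_mem_nhdsWithin] with h hh
      refine (integral_mul_linear_law (U := fun ω => onSpace M h (v h ω)) (hv h hh) ?_ ℓ).symm
      exact (hψ.integrable.comp_fst P).smul_bdd C (hv h hh).aestronglyMeasurable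
        (Eventually.of_forall fun p => hC h hh _ _)
    exact h2.limsup_eq.le

theorem integrable_mul_integral_law {U : Ω → Space d → Phase N}
    (hU : Measurable fun p : Space d × Ω => U p.2 p.1) {η : Phase N → ℝ} (hη : Continuous η)
    (hL : PairingLocallyIntegrable volume (law P U) η) {ψ : Space d → ℝ} (hψ : IsSpatialTest ψ) :
    Integrable fun x => ψ x * ∫ ξ, η ξ ∂(law P U x) := by
  have hUx : ∀ x, Measurable fun ω => U ω x := fun x => hU.comp measurable_prodMk_left
  have h1 : (fun x => ∫ ξ, η ξ ∂(law P U x)) = fun x => ∫ ω, η (U ω x) ∂P := by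
    ext x
    exact integral_law (hUx x) hη
  have h2 : LocallyIntegrable fun x => ∫ ξ, η ξ ∂(law P U x) := by
    refine hL.2.mono ?_ (Eventually.of_forall fun x => ?_)
    · rw [h1]
      exact ((hη.measurable.comp hU).stronglyMeasurable.integral_prod_right').aestronglyMeasurable
    · exact (norm_integral_le_integral_norm _).trans (Real.le_norm_self _)
  exact h2.integrable_smul_left_of_hasCompactSupport hψ.1.continuous hψ.2

theorem locallyIntegrable_comp_of_memLp_top {u₀ : Space d → Phase N} (hu₀ : Measurable u₀)
    (hu₀_top : MemLp u₀ ⊤ volume) {V : Type*} [NormedAddCommGroup V] [MeasurableSpace V]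
    [BorelSpace V] [SecondCountableTopology V] {g : Phase N → V} (hg : Continuous g) :
    LocallyIntegrable fun x => g (u₀ x) := by
  have hae : ∀ᵐ x, ‖u₀ x‖ ≤ (eLpNormEssSup u₀ volume).toReal := by
    filter_upwards [ae_le_eLpNormEssSup (f := u₀) (μ := volume)] with x hx
    have hfin : eLpNormEssSup u₀ volume ≠ ∞ := by
      have := hu₀_top.2.ne
      rwa [eLpNorm_exponent_top] at this
    rw [← toReal_enorm]
    exact ENNReal.toReal_mono hfin hx
  obtain ⟨B, -, hB⟩ := exists_bound_on_ball hg (eLpNormEssSup u₀ volume).toReal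
  refine (locallyIntegrable_const B).mono (hg.measurable.comp hu₀).aestronglyMeasurable ?_
  filter_upwards [hae] with x hx
  exact (hB _ hx).trans (Real.le_norm_self _)

/-- Convexity of the entropy controls the perturbation: `u₀ + ε X` is a convex combination of `u₀`
and `u₀ + ε₀ X`. -/
theorem integral_mul_law_le_of_convex {u₀ : Space d → Phase N} {X : Ω → Space d → Phase N}
    (hu₀ : Measurable u₀) (hu₀_top : MemLp u₀ ⊤ volume) (hX : Measurable (Function.uncurry X))
    {η : Phase N → ℝ} (hη : ConvexOn ℝ univ η) (hηc : Continuous η) {ε₀ ε : ℝ}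
    (hε : ε ∈ Ioc 0 ε₀)
    (hL : PairingLocallyIntegrable volume (law P fun ω x => u₀ x + ε • X ω x) η)
    (hL₀ : PairingLocallyIntegrable volume (law P fun ω x => u₀ x + ε₀ • X ω x) η)
    {ψ : Space d → ℝ} (hψ : IsSpatialTest ψ) (hpos : ∀ x, 0 ≤ ψ x) :
    ∫ x, ψ x * ∫ ξ, η ξ ∂(law P (fun ω x => u₀ x + ε • X ω x) x) ≤
      (1 - ε / ε₀) * (∫ x, ψ x * η (u₀ x))
        + ε / ε₀ * ∫ x, ψ x * ∫ ξ, η ξ ∂(law P (fun ω x => u₀ x + ε₀ • X ω x) x) := by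
  have hε₀ : 0 < ε₀ := hε.1.trans_le hε.2
  set θ := ε / ε₀ with hθ
  have hθ0 : 0 ≤ θ := div_nonneg hε.1.le hε₀.le
  have hθ1 : 0 ≤ 1 - θ := sub_nonneg.2 ((div_le_one hε₀).2 hε.2)
  have hm := fun ε => measurable_perturbation hu₀ hX ε
  have hmx : ∀ ε x, Measurable fun ω => u₀ x + ε • X ω x := fun ε x =>
    (hm ε).comp measurable_prodMk_left
  have i1 := integrable_mul_integral_law (P := P) (hm ε) hηc hL hψ
  have i2 := integrable_mul_integral_law (P := P) (hm ε₀) hηc hL₀ hψ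
  have i3 : Integrable fun x => ψ x * η (u₀ x) :=
    (locallyIntegrable_comp_of_memLp_top hu₀ hu₀_top
      hηc).integrable_smul_left_of_hasCompactSupport hψ.1.continuous hψ.2
  rw [← integral_const_mul, ← integral_const_mul,
    ← integral_add (i3.const_mul _) (i2.const_mul _)]
  refine integral_mono_ae i1 ((i3.const_mul _).add (i2.const_mul _)) ?_
  filter_upwards [hL.1, hL₀.1] with x hx hx₀
  have j1 : Integrable (fun ω => η (u₀ x + ε • X ω x)) P :=
    (integrable_map_measure hηc.aestronglyMeasurable (hmx ε x).aemeasurable).1 hx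
  have j2 : Integrable (fun ω => η (u₀ x + ε₀ • X ω x)) P :=
    (integrable_map_measure hηc.aestronglyMeasurable (hmx ε₀ x).aemeasurable).1 hx₀
  have key : ∫ ω, η (u₀ x + ε • X ω x) ∂P
      ≤ (1 - θ) * η (u₀ x) + θ * ∫ ω, η (u₀ x + ε₀ • X ω x) ∂P := by
    have h1 : ∫ ω, ((1 - θ) * η (u₀ x) + θ * η (u₀ x + ε₀ • X ω x)) ∂P
        = (1 - θ) * η (u₀ x) + θ * ∫ ω, η (u₀ x + ε₀ • X ω x) ∂P := by
      rw [integral_add (integrable_const _) (j2.const_mul _), integral_const, integral_const_mul]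
      simp
    rw [← h1]
    refine integral_mono j1 ((integrable_const _).add (j2.const_mul _)) fun ω => ?_
    have h2 := hη.2 (mem_univ (u₀ x)) (mem_univ (u₀ x + ε₀ • X ω x)) hθ1 hθ0 (by ring)
    have h3 : (1 - θ) • u₀ x + θ • (u₀ x + ε₀ • X ω x) = u₀ x + ε • X ω x := by
      have h4 : θ * ε₀ = ε := div_mul_cancel₀ _ hε₀.ne'
      rw [smul_add, smul_smul, h4, ← add_assoc, ← add_smul, sub_add_cancel, one_smul]
    rw [h3] at h2
    exact h2
  rw [integral_law (U := fun ω x => u₀ x + ε • X ω x) (hmx ε x) hηc,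
    integral_law (U := fun ω x => u₀ x + ε₀ • X ω x) (hmx ε₀ x) hηc]
  have := mul_le_mul_of_nonneg_left key (hpos x)
  linarith

end InitialData

/-! ### From couplings to entropy measure-valued solutions -/

section Disintegration

variable {d N : ℕ} {C : ℝ} [Nonempty (Metric.closedBall (0 : Phase N) C)]

/-- The Young measure on space-time obtained by disintegrating a coupling. -/
noncomputable def youngOfCoupling
    (μ : ProbabilityMeasure ((Space d × ℝ) × Metric.closedBall (0 : Phase N) C)) :
    Space d × ℝ → Measure (Phase N) :=
  fun z => ((μ : Measure ((Space d × ℝ) × Metric.closedBall (0 : Phase N) C)).condKernel z).map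
    Subtype.val

variable (μ : ProbabilityMeasure ((Space d × ℝ) × Metric.closedBall (0 : Phase N) C))

instance (z : Space d × ℝ) : IsProbabilityMeasure (youngOfCoupling μ z) :=
  Measure.isProbabilityMeasure_map measurable_subtype_coe.aemeasurable

theorem integral_youngOfCoupling {V : Type*} [NormedAddCommGroup V] [NormedSpace ℝ V]
    {g : Phase N → V} (hg : Continuous g) (z : Space d × ℝ) :
    ∫ ξ, g ξ ∂(youngOfCoupling μ z) = ∫ y, g y
      ∂((μ : Measure ((Space d × ℝ) × Metric.closedBall (0 : Phase N) C)).condKernel z) :=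
  integral_map measurable_subtype_coe.aemeasurable hg.aestronglyMeasurable

theorem ae_norm_le_youngOfCoupling (z : Space d × ℝ) : ∀ᵐ ξ ∂(youngOfCoupling μ z), ‖ξ‖ ≤ C := by
  refine (ae_map_iff measurable_subtype_coe.aemeasurable
    (isClosed_le continuous_norm continuous_const).measurableSet).2 ?_
  exact Eventually.of_forall fun y => mem_closedBall_zero_iff.1 y.2

theorem stronglyMeasurable_integral_youngOfCoupling {V : Type*} [NormedAddCommGroup V]
    [NormedSpace ℝ V] {g : Phase N → V} (hg : Continuous g) :
    StronglyMeasurable fun z => ∫ ξ, g ξ ∂(youngOfCoupling μ z) := by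
  simp only [integral_youngOfCoupling μ hg]
  exact (hg.comp continuous_subtype_val).stronglyMeasurable.integral_kernel

theorem isYoungMeasure_youngOfCoupling : IsYoungMeasure (youngOfCoupling μ) :=
  ⟨fun _ => inferInstance, fun g =>
    (stronglyMeasurable_integral_youngOfCoupling μ (map_continuous g)).measurable⟩

theorem integrable_youngOfCoupling {V : Type*} [NormedAddCommGroup V]
    {g : Phase N → V} (hg : Continuous g) (z : Space d × ℝ) :
    Integrable g (youngOfCoupling μ z) := by
  obtain ⟨B, -, hB⟩ := exists_bound_on_ball hg C
  exact Integrable.of_bound hg.aestronglyMeasurable B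
    ((ae_norm_le_youngOfCoupling μ z).mono fun ξ hξ => hB ξ hξ)

theorem exists_norm_integral_youngOfCoupling_le {V : Type*} [NormedAddCommGroup V]
    [NormedSpace ℝ V] {g : Phase N → V} (hg : Continuous g) :
    ∃ B, ∀ z, ‖∫ ξ, g ξ ∂(youngOfCoupling μ z)‖ ≤ B := by
  obtain ⟨B, -, hB⟩ := exists_bound_on_ball hg C
  refine ⟨B, fun z => ?_⟩
  have := norm_integral_le_of_norm_le_const
    ((ae_norm_le_youngOfCoupling μ z).mono fun ξ hξ => hB ξ hξ)
  simpa using this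

theorem pairingLocallyIntegrable_youngOfCoupling {V : Type*} [NormedAddCommGroup V]
    {g : Phase N → V} (hg : Continuous g) :
    PairingLocallyIntegrable (spaceTime d) (youngOfCoupling μ) g := by
  refine ⟨Eventually.of_forall fun z => integrable_youngOfCoupling μ hg z, ?_⟩
  obtain ⟨B, hB⟩ := exists_norm_integral_youngOfCoupling_le μ hg.norm
  refine (locallyIntegrable_const B).mono
    (stronglyMeasurable_integral_youngOfCoupling μ hg.norm).aestronglyMeasurable
    (Eventually.of_forall fun z => (hB z).trans (Real.le_norm_self _))

theorem integrable_smul_integral_youngOfCoupling {V : Type*} [NormedAddCommGroup V]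
    [NormedSpace ℝ V] {g : Phase N → V} (hg : Continuous g) {φ : Space d × ℝ → ℝ}
    (hφ : Integrable φ (spaceTime d)) :
    Integrable (fun z => φ z • ∫ ξ, g ξ ∂(youngOfCoupling μ z)) (spaceTime d) := by
  obtain ⟨B, hB⟩ := exists_norm_integral_youngOfCoupling_le μ hg
  exact hφ.smul_bdd B (stronglyMeasurable_integral_youngOfCoupling μ hg).aestronglyMeasurable
    (Eventually.of_forall hB)

variable {μ}

theorem couplingPairing_eq_youngOfCoupling (hμ : μ ∈ couplings _ (spaceTime d).toFinite)
    {φ : Space d × ℝ → ℝ} (hφ : Integrable φ (spaceTime d)) {g : Phase N → ℝ}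
    (hg : Continuous g) :
    couplingPairing (spaceTime d) φ (fun y : Metric.closedBall (0 : Phase N) C => g y) μ
      = ∫ z, φ z * ∫ ξ, g ξ ∂(youngOfCoupling μ z) ∂(spaceTime d) := by
  simp only [integral_youngOfCoupling μ hg]
  exact couplingPairing_eq_condKernel hμ hφ (hg.comp continuous_subtype_val)

theorem entropyProduction_eq_integral (hμ : μ ∈ couplings _ (spaceTime d).toFinite)
    {φ : Space d × ℝ → ℝ} (hφ : IsTest φ) {η : Phase N → ℝ} (hη : Continuous η)
    {q : Fin d → Phase N → ℝ} (hq : ∀ k, Continuous (q k)) :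
    entropyProduction φ η q μ = ∫ z, (dt φ z * (∫ ξ, η ξ ∂(youngOfCoupling μ z))
      + ∑ k, dx k φ z * ∫ ξ, q k ξ ∂(youngOfCoupling μ z)) ∂(spaceTime d) := by
  have i1 := integrable_smul_integral_youngOfCoupling μ hη hφ.integrable_dt
  have i2 := fun k => integrable_smul_integral_youngOfCoupling μ (hq k) (hφ.integrable_dx k)
  simp only [smul_eq_mul] at i1 i2
  rw [integral_add i1 (integrable_finsetSum _ fun k _ => i2 k),
    integral_finsetSum _ fun k _ => i2 k, entropyProduction,
    couplingPairing_eq_youngOfCoupling hμ hφ.integrable_dt hη]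
  congr 1
  exact Finset.sum_congr rfl fun k _ =>
    couplingPairing_eq_youngOfCoupling hμ (hφ.integrable_dx k) (hq k)

theorem couplingPairing_add (hμ : μ ∈ couplings _ (spaceTime d).toFinite)
    {φ ψ : Space d × ℝ → ℝ} (hφ : Integrable φ (spaceTime d)) (hψ : Integrable ψ (spaceTime d))
    {g : Phase N → ℝ} (hg : Continuous g) :
    couplingPairing (spaceTime d) (φ + ψ) (fun y : Metric.closedBall (0 : Phase N) C => g y) μ
      = couplingPairing (spaceTime d) φ (fun y : Metric.closedBall (0 : Phase N) C => g y) μ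
      + couplingPairing (spaceTime d) ψ (fun y : Metric.closedBall (0 : Phase N) C => g y) μ := by
  have hg' : Continuous fun y : Metric.closedBall (0 : Phase N) C => g y :=
    hg.comp continuous_subtype_val
  unfold couplingPairing
  rw [← integral_add (integrable_mul_of_coupling hμ (integrable_density_mul hφ) hg')
    (integrable_mul_of_coupling hμ (integrable_density_mul hψ) hg')]
  refine integral_congr_ae (Eventually.of_forall fun p => ?_)
  simp only [Pi.add_apply]
  ring

theorem entropyProduction_add (hμ : μ ∈ couplings _ (spaceTime d).toFinite)
    {φ ψ : Space d × ℝ → ℝ} (hφ : IsTest φ) (hψ : IsTest ψ) {η : Phase N → ℝ}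
    (hη : Continuous η) {q : Fin d → Phase N → ℝ} (hq : ∀ k, Continuous (q k)) :
    entropyProduction (φ + ψ) η q μ = entropyProduction φ η q μ + entropyProduction ψ η q μ := by
  have h1 : dt (φ + ψ) = dt φ + dt ψ := by
    ext z
    simp [dt, fderiv_add (hφ.differentiable z) (hψ.differentiable z)]
  have h2 : ∀ k, dx k (φ + ψ) = dx k φ + dx k ψ := fun k => by
    ext z
    simp [dx, fderiv_add (hφ.differentiable z) (hψ.differentiable z)]
  unfold entropyProduction
  simp only [h1, h2]
  rw [couplingPairing_add hμ hφ.integrable_dt hψ.integrable_dt hη]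
  simp only [fun k => couplingPairing_add hμ (hφ.integrable_dx k) (hψ.integrable_dx k) (hq k)]
  rw [Finset.sum_add_distrib]
  ring

theorem entropyProduction_neg {φ : Space d × ℝ → ℝ} {η : Phase N → ℝ}
    {q : Fin d → Phase N → ℝ} :
    entropyProduction φ (fun ξ => -η ξ) (fun k ξ => -q k ξ) μ = -entropyProduction φ η q μ := by
  simp only [entropyProduction, couplingPairing, mul_neg, integral_neg, Finset.sum_neg_distrib,
    neg_add]

/-- A test function is the difference of two nonnegative ones. -/
theorem IsTest.exists_add_nonneg {φ : Space d × ℝ → ℝ} (hφ : IsTest φ) :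
    ∃ χ : Space d × ℝ → ℝ, IsTest χ ∧ (∀ z, 0 ≤ χ z) ∧ ∀ z, 0 ≤ (φ + χ) z := by
  obtain ⟨B, hB⟩ := hφ.2.exists_bound_of_continuous hφ.1.continuous
  obtain ⟨R, hR⟩ := hφ.2.isBounded.subset_closedBall 0
  let b : ContDiffBump (0 : Space d × ℝ) :=
    ⟨max R 1, max R 1 + 1, by positivity, by linarith⟩
  have hB0 : 0 ≤ B := (norm_nonneg _).trans (hB 0)
  refine ⟨fun z => B * b z, ⟨contDiff_const.mul b.contDiff, b.hasCompactSupport.mul_left⟩,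
    fun z => mul_nonneg hB0 b.nonneg, fun z => ?_⟩
  rw [Pi.add_apply]
  by_cases hz : z ∈ tsupport φ
  · have h1 : b z = 1 := b.one_of_mem_closedBall
      (Metric.closedBall_subset_closedBall (le_max_left _ _) (hR hz))
    rw [h1, mul_one]
    linarith [neg_abs_le (φ z), hB z, Real.norm_eq_abs (φ z)]
  · rw [image_eq_zero_of_notMem_tsupport hz, zero_add]
    exact mul_nonneg hB0 b.nonneg

theorem pairingLocallyIntegrable_atomic {u₀ : Space d → Phase N} (hu₀ : Measurable u₀)
    (hu₀_top : MemLp u₀ ⊤ volume) {V : Type*} [NormedAddCommGroup V] {g : Phase N → V}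
    (hg : Continuous g) : PairingLocallyIntegrable volume (atomic u₀) g := by
  refine ⟨Eventually.of_forall fun x => integrable_dirac (by simp), ?_⟩
  have := locallyIntegrable_comp_of_memLp_top hu₀ hu₀_top hg.norm
  simpa [atomic] using this

/-- The mean equation is the conjunction of the entropy inequalities for the linear entropies
`ℓ` and `-ℓ`. -/
theorem youngOfCoupling_mem_emvSolutions (hμ : μ ∈ couplings _ (spaceTime d).toFinite)
    {f : Fin d → Phase N → Phase N} (hf : ∀ k, Continuous (f k))
    {E : Set ((Phase N → ℝ) × (Fin d → Phase N → ℝ))} (hE : ∀ e ∈ E, Continuous e.1)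
    (hE' : ∀ e ∈ E, ∀ k, Continuous (e.2 k)) {u₀ : Space d → Phase N} (hu₀ : Measurable u₀)
    (hu₀_top : MemLp u₀ ⊤ volume)
    (hlin : ∀ (ℓ : Phase N →L[ℝ] ℝ) (φ : Space d × ℝ → ℝ), IsTest φ →
      (∀ x t, 0 ≤ t → 0 ≤ φ (x, t)) →
      0 ≤ entropyProduction φ ℓ (fun k ξ => ℓ (f k ξ)) μ + ∫ x, φ (x, 0) * ℓ (u₀ x))
    (hent : ∀ e ∈ E, ∀ φ : Space d × ℝ → ℝ, IsTest φ → (∀ x t, 0 ≤ t → 0 ≤ φ (x, t)) →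
      0 ≤ entropyProduction φ e.1 e.2 μ + ∫ x, φ (x, 0) * e.1 (u₀ x)) :
    youngOfCoupling μ ∈ emvSolutions f E (atomic u₀) := by
  have hintφ : ∀ {V : Type} [NormedAddCommGroup V] [NormedSpace ℝ V] [MeasurableSpace V]
      [BorelSpace V] [SecondCountableTopology V] {g : Phase N → V}, Continuous g →
      ∀ {φ : Space d × ℝ → ℝ}, IsTest φ → Integrable fun x => φ (x, 0) • g (u₀ x) := by
    intro V _ _ _ _ _ g hg φ hφ
    exact (locallyIntegrable_comp_of_memLp_top hu₀ hu₀_top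
      hg).integrable_smul_left_of_hasCompactSupport hφ.initial.1.continuous hφ.initial.2
  have hℓf : ∀ (ℓ : Phase N →L[ℝ] ℝ) k, Continuous fun ξ => ℓ (f k ξ) := fun ℓ k =>
    ℓ.continuous.comp (hf k)
  -- equality for linear entropies and nonnegative test functions
  have hzero_pos : ∀ (ℓ : Phase N →L[ℝ] ℝ) (φ : Space d × ℝ → ℝ), IsTest φ →
      (∀ z, 0 ≤ φ z) →
      entropyProduction φ ℓ (fun k ξ => ℓ (f k ξ)) μ + ∫ x, φ (x, 0) * ℓ (u₀ x) = 0 := by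
    intro ℓ φ hφ hpos
    have h1 := hlin ℓ φ hφ fun x t _ => hpos _
    have h2 := hlin (-ℓ) φ hφ fun x t _ => hpos _
    have h3 : entropyProduction φ (-ℓ : Phase N →L[ℝ] ℝ) (fun k ξ => (-ℓ : Phase N →L[ℝ] ℝ) (f k ξ)) μ
        = -entropyProduction φ ℓ (fun k ξ => ℓ (f k ξ)) μ := entropyProduction_neg
    have h4 : ∫ x, φ (x, 0) * (-ℓ : Phase N →L[ℝ] ℝ) (u₀ x) = -∫ x, φ (x, 0) * ℓ (u₀ x) := by
      rw [← integral_neg]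
      simp
    rw [h3, h4] at h2
    linarith
  have hzero : ∀ (ℓ : Phase N →L[ℝ] ℝ) (φ : Space d × ℝ → ℝ), IsTest φ →
      entropyProduction φ ℓ (fun k ξ => ℓ (f k ξ)) μ + ∫ x, φ (x, 0) * ℓ (u₀ x) = 0 := by
    intro ℓ φ hφ
    obtain ⟨χ, hχ, hχ0, hφχ⟩ := hφ.exists_add_nonneg
    have h1 := hzero_pos ℓ χ hχ hχ0
    have h2 := hzero_pos ℓ (φ + χ) ⟨hφ.1.add hχ.1, hφ.2.add hχ.2⟩ hφχ
    rw [entropyProduction_add hμ hφ hχ ℓ.continuous (hℓf ℓ)] at h2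
    have h3 : ∫ x, (φ + χ) (x, 0) * ℓ (u₀ x)
        = (∫ x, φ (x, 0) * ℓ (u₀ x)) + ∫ x, χ (x, 0) * ℓ (u₀ x) := by
      have i1 := hintφ ℓ.continuous hφ
      have i2 := hintφ ℓ.continuous hχ
      simp only [smul_eq_mul] at i1 i2
      rw [← integral_add i1 i2]
      simp only [Pi.add_apply, add_mul]
    rw [h3] at h2
    linarith
  refine ⟨⟨isYoungMeasure_youngOfCoupling μ,
    pairingLocallyIntegrable_youngOfCoupling μ continuous_id,
    fun k => pairingLocallyIntegrable_youngOfCoupling μ (hf k),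
    pairingLocallyIntegrable_atomic hu₀ hu₀_top continuous_id, fun φ hφ => ?_⟩,
    fun e he => ⟨pairingLocallyIntegrable_youngOfCoupling μ (hE e he),
      fun k => pairingLocallyIntegrable_youngOfCoupling μ (hE' e he k),
      pairingLocallyIntegrable_atomic hu₀ hu₀_top (hE e he), fun φ hφ hpos => ?_⟩⟩
  · refine SeparatingDual.eq_zero_of_forall_dual_eq_zero (R := ℝ) fun ℓ => ?_
    have j1 := integrable_smul_integral_youngOfCoupling μ continuous_id' hφ.integrable_dt
    have j2 := fun k => integrable_smul_integral_youngOfCoupling μ (hf k) (hφ.integrable_dx k)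
    have j3 := hintφ continuous_id' hφ
    simp only [atomic, integral_dirac]
    refine Eq.trans ?_ (hzero ℓ φ hφ)
    rw [map_add, ← ℓ.integral_comp_comm (by exact j1.add (integrable_finsetSum _ fun k _ => j2 k)),
      ← ℓ.integral_comp_comm j3, entropyProduction_eq_integral hμ hφ ℓ.continuous
        (hℓf ℓ)]
    simp only [map_add, map_sum, map_smul, smul_eq_mul]
    congr 1
    refine integral_congr_ae (Eventually.of_forall fun z => ?_)
    simp only
    rw [← ℓ.integral_comp_comm (integrable_youngOfCoupling μ continuous_id' z)]
    congr 1
    refine Finset.sum_congr rfl fun k _ => ?_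
    rw [← ℓ.integral_comp_comm (integrable_youngOfCoupling μ (hf k) z)]
  · rw [← entropyProduction_eq_integral hμ hφ (hE e he) (hE' e he)]
    simpa [atomic] using hent e he φ hφ hpos

end Disintegration

/-! ### Passage to the limit of vanishing perturbations -/

section Limit

variable {d N : ℕ} {Ω : Type*} [MeasurableSpace Ω] {P : Measure Ω} [IsProbabilityMeasure P]

theorem EntropyMeanConsistent.congr {η : Phase N → ℝ} {σh τh : ℝ → Space d → Measure (Phase N)}
    {σ : Space d → Measure (Phase N)} (h : EntropyMeanConsistent η σh σ)
    (heq : ∀ h, 0 < h → σh h = τh h) : EntropyMeanConsistent η τh σ := by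
  refine ⟨h.1, fun ψ hψ hpos => ?_⟩
  rw [← limsup_congr (u := fun h => ((∫ x, ψ x * ∫ ξ, η ξ ∂(σh h x) : ℝ) : EReal))]
  · exact h.2 ψ hψ hpos
  · filter_upwards [self_mem_nhdsWithin] with h hh
    rw [heq h hh]

theorem exists_tendsto_coupling {M : Mesh d} {C : ℝ} {u : ℝ → Ω → ℝ → Grid d → Phase N}
    (hu : ∀ h, 0 < h → IsBoundedField C (u h)) :
    ∃ μ ∈ couplings (Metric.closedBall (0 : Phase N) C) (spaceTime d).toFinite,
      ∃ (h : ℕ → ℝ) (hh : ∀ n, 0 < h n), Tendsto h atTop (𝓝 0) ∧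
        Tendsto (fun n => (hu (h n) (hh n)).coupling M (h n) P) atTop (𝓝 μ) := by
  have hpos : ∀ n : ℕ, 0 < 1 / ((n : ℝ) + 1) := fun n => by positivity
  obtain ⟨μ, hμ, s, hs, hlim⟩ := (isCompact_couplings (Y := Metric.closedBall (0 : Phase N) C)
    (spaceTime d).toFinite).tendsto_subseq
    (x := fun n : ℕ => (hu _ (hpos n)).coupling M (1 / ((n : ℝ) + 1)) P)
    fun n => (hu _ (hpos n)).coupling_mem M _ P
  exact ⟨μ, hμ, fun n => 1 / ((s n : ℝ) + 1), fun n => hpos _,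
    (tendsto_one_div_add_atTop_nhds_zero_nat (𝕜 := ℝ)).comp hs.tendsto_atTop, hlim⟩

/-- If the entropy inequality with initial law that of `u₀ + ε X` holds for couplings that converge
as `ε → 0`, the limit satisfies the inequality with the atomic initial datum `u₀`. -/
theorem entropyProduction_add_atomic_nonneg {C : ℝ} {u₀ : Space d → Phase N}
    {X : Ω → Space d → Phase N} (hu₀ : Measurable u₀) (hu₀_top : MemLp u₀ ⊤ volume)
    (hX : Measurable (Function.uncurry X)) {η : Phase N → ℝ} (hη : ConvexOn ℝ univ η)
    {q : Fin d → Phase N → ℝ} (hq : ∀ k, Continuous (q k)) {ε₀ : ℝ} (hε₀ : 0 < ε₀)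
    (hL : ∀ ε ∈ Ioc 0 ε₀,
      PairingLocallyIntegrable volume (law P fun ω x => u₀ x + ε • X ω x) η)
    {ε : ℕ → ℝ} (hε : ∀ n, ε n ∈ Ioc 0 ε₀) (hlim : Tendsto ε atTop (𝓝 0))
    {μs : ℕ → ProbabilityMeasure ((Space d × ℝ) × Metric.closedBall (0 : Phase N) C)}
    {μ : ProbabilityMeasure ((Space d × ℝ) × Metric.closedBall (0 : Phase N) C)}
    (hμs : ∀ n, μs n ∈ couplings _ (spaceTime d).toFinite)
    (hμ : μ ∈ couplings _ (spaceTime d).toFinite) (hμlim : Tendsto μs atTop (𝓝 μ))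
    {φ : Space d × ℝ → ℝ} (hφ : IsTest φ) (hpos : ∀ x t, 0 ≤ t → 0 ≤ φ (x, t))
    (hent : ∀ n, 0 ≤ entropyProduction φ η q (μs n)
      + ∫ x, φ (x, 0) * ∫ ξ, η ξ ∂(law P (fun ω x => u₀ x + ε n • X ω x) x)) :
    0 ≤ entropyProduction φ η q μ + ∫ x, φ (x, 0) * η (u₀ x) := by
  have hηc := hη.locallyLipschitz.continuous
  have h1 := tendsto_entropyProduction (Eventually.of_forall hμs) hμ hμlim hφ hηc hq
  set a := ∫ x, φ (x, 0) * η (u₀ x)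
  set b := ∫ x, φ (x, 0) * ∫ ξ, η ξ ∂(law P (fun ω x => u₀ x + ε₀ • X ω x) x)
  have hθ : Tendsto (fun n => ε n / ε₀) atTop (𝓝 0) := by simpa using hlim.div_const ε₀
  have h2 : Tendsto (fun n => entropyProduction φ η q (μs n)
      + ((1 - ε n / ε₀) * a + ε n / ε₀ * b)) atTop
      (𝓝 (entropyProduction φ η q μ + ((1 - 0) * a + 0 * b))) :=
    h1.add (((tendsto_const_nhds.sub hθ).mul_const a).add (hθ.mul_const b))
  rw [sub_zero, one_mul, zero_mul, add_zero] at h2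
  refine ge_of_tendsto h2 (Eventually.of_forall fun n => (hent n).trans ?_)
  gcongr
  exact integral_mul_law_le_of_convex hu₀ hu₀_top hX hη hηc (hε n) (hL _ (hε n))
    (hL _ ⟨hε₀, le_rfl⟩) hφ.initial fun x => hpos x 0 le_rfl

/-- A diagonal sequence: if `b n → x` and each `b n` is a limit of values of `a n` along positive
parameters tending to zero, then values of `a n` at parameters tending to zero converge to `x`. -/
theorem exists_diagonal_tendsto {T : Type*} [TopologicalSpace T]
    [TopologicalSpace.MetrizableSpace T] {b : ℕ → T} {x : T} (hb : Tendsto b atTop (𝓝 x))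
    {a : ℕ → ℕ → T} {h : ℕ → ℕ → ℝ} (hh : ∀ n k, 0 < h n k)
    (hlim : ∀ n, Tendsto (h n) atTop (𝓝 0)) (ha : ∀ n, Tendsto (a n) atTop (𝓝 (b n))) :
    ∃ k : ℕ → ℕ, Tendsto (fun n => h n (k n)) atTop (𝓝 0) ∧
      Tendsto (fun n => a n (k n)) atTop (𝓝 x) := by
  let := TopologicalSpace.metrizableSpaceMetric T
  have hpos : ∀ n : ℕ, 0 < 1 / ((n : ℝ) + 1) := fun n => by positivity
  have hex : ∀ n, ∃ k, h n k < 1 / ((n : ℝ) + 1) ∧ dist (a n k) (b n) < 1 / ((n : ℝ) + 1) :=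
    fun n => (((hlim n).eventually_lt_const (hpos n)).and
      (Metric.tendsto_nhds.1 (ha n) _ (hpos n))).exists
  choose k hk using hex
  have h0 := tendsto_one_div_add_atTop_nhds_zero_nat (𝕜 := ℝ)
  refine ⟨k, squeeze_zero (fun n => (hh n _).le) (fun n => (hk n).1.le) h0, ?_⟩
  refine hb.congr_dist (squeeze_zero (fun n => dist_nonneg) (fun n => ?_) h0)
  rw [dist_comm]
  exact (hk n).2.le

end Limit

end EMV

theorem mainTheorem3 {d N : ℕ}
    -- the system of conservation laws and the class of entropy pairs
    (f : Fin d → EMV.Phase N → EMV.Phase N) (hf : ∀ k, ContDiff ℝ 1 (f k))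
    (E : Set ((EMV.Phase N → ℝ) × (Fin d → EMV.Phase N → ℝ))) (hE : E ⊆ EMV.entropyPairs f)
    -- the unperturbed initial data
    (u₀ : EMV.Space d → EMV.Phase N) (hu₀ : Measurable u₀)
    (hu₀_one : MemLp u₀ 1 volume) (hu₀_top : MemLp u₀ ⊤ volume)
    -- the random perturbation
    {Ω : Type*} [MeasurableSpace Ω] (P : Measure Ω) [IsProbabilityMeasure P]
    (X : Ω → EMV.Space d → EMV.Phase N) (hX : Measurable (Function.uncurry X))
    (hX_one : ∀ ω, MemLp (X ω) 1 volume) (hX_top : ∀ ω, MemLp (X ω) ⊤ volume)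
    (hX_norm : ∀ᵐ ω ∂P, eLpNorm (X ω) 1 volume ≤ 1)
    -- the numerical scheme and its evolution operator `S`
    (M : EMV.Mesh d) (p : ℕ) (hp : 1 ≤ p)
    (F : Fin d → ℝ → (EMV.stencil d p → EMV.Phase N) → EMV.Phase N)
    (hF : ∀ k, EMV.ConsistentFlux (F k) (f k))
    (S : ℝ → (EMV.Grid d → EMV.Phase N) → ℝ → EMV.Grid d → EMV.Phase N)
    -- `v h ε ω` is the discretization, on the mesh of size `h`, of `u₀ + ε X(ω)`
    (ε₀ : ℝ) (hε₀ : 0 < ε₀) (v : ℝ → ℝ → Ω → EMV.Grid d → EMV.Phase N)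
    (hS : ∀ h, 0 < h → ∀ ε ∈ Ioc 0 ε₀, ∀ ω,
      EMV.IsSchemeSolution M h (fun k => F k h) (v h ε ω) (S h (v h ε ω)))
    (hmeas : ∀ h, 0 < h → ∀ ε ∈ Ioc 0 ε₀, ∀ t, 0 ≤ t → ∀ i,
      Measurable fun ω => S h (v h ε ω) t i)
    -- uniform boundedness
    (hbound : ∃ C : ℝ, ∀ h, 0 < h → ∀ ε ∈ Ioc 0 ε₀, ∀ ω t, 0 ≤ t → ∀ i,
      ‖S h (v h ε ω) t i‖ ≤ C)
    -- weak BV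
    (hbv : ∀ ε ∈ Ioc 0 ε₀, EMV.WeakBV M fun h ω => S h (v h ε ω))
    -- entropy consistency
    (hentropy : ∀ ε ∈ Ioc 0 ε₀, ∀ e ∈ E,
      EMV.EntropyConsistent M e.1 e.2 fun h ω => S h (v h ε ω))
    -- consistency with the initial data
    (hinit : ∀ ε ∈ Ioc 0 ε₀,
      EMV.MeanConsistent (fun h => EMV.law P fun ω => EMV.onSpace M h (v h ε ω))
        (EMV.law P fun ω x => u₀ x + ε • X ω x))
    (hinit_entropy : ∀ ε ∈ Ioc 0 ε₀, ∀ e ∈ E,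
      EMV.EntropyMeanConsistent e.1 (fun h => EMV.law P fun ω => EMV.onSpace M h (v h ε ω))
        (EMV.law P fun ω x => u₀ x + ε • X ω x)) :
    ∃ h ε : ℕ → ℝ, (∀ n, 0 < h n) ∧ (∀ n, ε n ∈ Ioc 0 ε₀) ∧
      Tendsto h atTop (𝓝 0) ∧ Tendsto ε atTop (𝓝 0) ∧
      ∃ ν ∈ EMV.emvSolutions f E (EMV.atomic u₀),
        EMV.WeakStarTendsto (EMV.spaceTime d)
          (fun n => EMV.law P fun ω => EMV.onSpaceTime M (h n) (S (h n) (v (h n) (ε n) ω))) ν := by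
  obtain ⟨C, hC⟩ := hbound
  have hε₀mem : ε₀ ∈ Ioc 0 ε₀ := ⟨hε₀, le_rfl⟩
  obtain ⟨ω₀⟩ : Nonempty Ω := nonempty_of_isProbabilityMeasure P
  have hC0 : 0 ≤ C := (norm_nonneg _).trans (hC 1 one_pos ε₀ hε₀mem ω₀ 0 le_rfl 0)
  have : Nonempty (Metric.closedBall (0 : EMV.Phase N) C) :=
    ⟨⟨0, by simpa using hC0⟩⟩
  have hfc : ∀ k, Continuous (f k) := fun k => (hf k).continuous
  -- freezing the numerical solutions at negative times makes them continuous on all of `ℝ`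
  let u : ℝ → ℝ → Ω → ℝ → EMV.Grid d → EMV.Phase N := fun ε h ω t => S h (v h ε ω) (max t 0)
  have hu : ∀ ε ∈ Ioc 0 ε₀, ∀ h, 0 < h → EMV.IsBoundedField C (u ε h) := fun ε hε h hh =>
    EMV.isBoundedField_scheme hF hfc hh (hS h hh ε hε) (hmeas h hh ε hε) (hC h hh ε hε)
  have hinit0 : ∀ ε ∈ Ioc 0 ε₀, ∀ h, 0 < h → ∀ ω, u ε h ω 0 = v h ε ω := fun ε hε h hh ω => by
    simp only [u, max_self]
    exact (hS h hh ε hε ω).init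
  have hlaw0 : ∀ ε ∈ Ioc 0 ε₀, ∀ h, 0 < h →
      EMV.law P (fun ω => EMV.onSpace M h (v h ε ω))
        = EMV.law P fun ω => EMV.onSpace M h (u ε h ω 0) := fun ε hε h hh => by
    simp only [hinit0 ε hε h hh]
  -- the entropy pairs for which the scheme is consistent: those in `E` and the linear ones
  let G : Set ((EMV.Phase N → ℝ) × (Fin d → EMV.Phase N → ℝ)) :=
    {e | ConvexOn ℝ univ e.1 ∧ (∀ k, Continuous (e.2 k)) ∧ ∀ ε ∈ Ioc 0 ε₀,
      EMV.EntropyConsistent M e.1 e.2 (u ε) ∧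
      EMV.EntropyMeanConsistent e.1 (fun h => EMV.law P fun ω => EMV.onSpace M h (u ε h ω 0))
        (EMV.law P fun ω x => u₀ x + ε • X ω x)}
  have hEG : ∀ e ∈ E, e ∈ G := fun e he =>
    ⟨(hE he).convex, fun k => continuous_iff_continuousAt.2 fun ξ =>
      ((hE he).compatible k ξ).continuousAt, fun ε hε =>
      ⟨(hentropy ε hε e he).comp_max, (hinit_entropy ε hε e he).congr (hlaw0 ε hε)⟩⟩
  have hXi := EMV.integrable_field_of_eLpNorm_le hX hX_norm
  have hlinG : ∀ ℓ : EMV.Phase N →L[ℝ] ℝ, ((ℓ, fun k ξ => ℓ (f k ξ)) :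
      (EMV.Phase N → ℝ) × (Fin d → EMV.Phase N → ℝ)) ∈ G := fun ℓ => by
    refine ⟨ℓ.toLinearMap.convexOn convex_univ, fun k => ℓ.continuous.comp (hfc k),
      fun ε hε => ⟨?_, ?_⟩⟩
    · exact (EMV.entropyConsistent_linear (u := fun h ω => S h (v h ε ω)) hp hF
        (fun h hh ω => hS h hh ε hε ω) ℓ).comp_max
    · refine (EMV.entropyMeanConsistent_linear (C := C) (v := fun h => v h ε) (fun h hh => ?_)
        (fun h hh ω i => ?_) (EMV.measurable_perturbation hu₀ hX ε)
        (EMV.integrable_perturbation hu₀_one hXi ε) (hinit ε hε) ℓ).congr (hlaw0 ε hε)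
      · have := (hu ε hε h hh).measurable_onSpace (M := M) h
        simpa only [hinit0 ε hε h hh] using this
      · rw [← hinit0 ε hε h hh]
        exact (hu ε hε h hh).bound ω 0 i
  -- vanishing mesh size for the fixed perturbations of size `ε₀ / (n + 1)`
  let ε : ℕ → ℝ := fun n => ε₀ / ((n : ℝ) + 1)
  have hε : ∀ n, ε n ∈ Ioc 0 ε₀ := fun n =>
    ⟨by positivity, div_le_self hε₀.le (by linarith [(Nat.cast_nonneg n : (0 : ℝ) ≤ n)])⟩
  have hεlim : Tendsto ε atTop (𝓝 0) := by
    have := (tendsto_one_div_add_atTop_nhds_zero_nat (𝕜 := ℝ)).const_mul ε₀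
    simpa [ε, div_eq_mul_inv] using this
  choose μs hμs h hh hhlim hμslim using fun n =>
    EMV.exists_tendsto_coupling (P := P) (M := M) (hu (ε n) (hε n))
  -- vanishing perturbations
  obtain ⟨μ, hμ, s, hs, hμlim⟩ := (EMV.isCompact_couplings
    (Y := Metric.closedBall (0 : EMV.Phase N) C) (EMV.spaceTime d).toFinite).tendsto_subseq hμs
  have hineq : ∀ e ∈ G, ∀ φ : EMV.Space d × ℝ → ℝ, EMV.IsTest φ →
      (∀ x t, 0 ≤ t → 0 ≤ φ (x, t)) →
      0 ≤ EMV.entropyProduction φ e.1 e.2 μ + ∫ x, φ (x, 0) * e.1 (u₀ x) := by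
    intro e he φ hφ hpos
    refine EMV.entropyProduction_add_atomic_nonneg (P := P) hu₀ hu₀_top hX he.1 he.2.1 hε₀
      (fun ε hε => (he.2.2 ε hε).2.1) (fun n => hε (s n)) (hεlim.comp hs.tendsto_atTop)
      (fun n => hμs (s n)) hμ hμlim hφ hpos fun n => ?_
    exact EMV.entropyProduction_add_nonneg (hu _ (hε (s n))) (hbv _ (hε (s n))).comp_max
      he.1.locallyLipschitz he.2.1 (he.2.2 _ (hε (s n))).1 (he.2.2 _ (hε (s n))).2
      (hh (s n)) (hhlim (s n)) (hμs (s n)) (hμslim (s n)) hφ hpos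
  obtain ⟨k, hklim, hlim⟩ := EMV.exists_diagonal_tendsto hμlim (fun n => hh (s n))
    (fun n => hhlim (s n)) (fun n => hμslim (s n))
  refine ⟨fun n => h (s n) (k n), fun n => ε (s n), fun n => hh _ _, fun n => hε _, hklim,
    hεlim.comp hs.tendsto_atTop, EMV.youngOfCoupling μ, ?_, ?_⟩
  · exact EMV.youngOfCoupling_mem_emvSolutions hμ hfc
      (fun e he => (hEG e he).1.locallyLipschitz.continuous) (fun e he => (hEG e he).2.1)
      hu₀ hu₀_top (fun ℓ => hineq _ (hlinG ℓ)) fun e he => hineq e (hEG e he)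
  · -- for nonnegative times the couplings carry the laws of the numerical solutions
    intro g φ hφ
    have hg : Continuous g := map_continuous g
    rw [← EMV.couplingPairing_eq_youngOfCoupling hμ hφ hg]
    refine (EMV.tendsto_couplingPairing (Eventually.of_forall fun n =>
      EMV.IsBoundedField.coupling_mem _ _ _ _) hμ hlim hφ
      (hg.comp continuous_subtype_val)).congr fun n => ?_
    refine (EMV.IsBoundedField.couplingPairing_coupling _ _ _ _ hφ hg).trans ?_
    refine integral_congr_ae ?_
    filter_upwards [ae_restrict_mem (MeasurableSet.univ.prod measurableSet_Ici)] with z hz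
    have hz0 : (0 : ℝ) ≤ z.2 := hz.2
    have hUz : ∀ ω, EMV.onSpaceTime M (h (s n) (k n)) (u (ε (s n)) (h (s n) (k n)) ω) z
        = EMV.onSpaceTime M (h (s n) (k n))
          (S (h (s n) (k n)) (v (h (s n) (k n)) (ε (s n)) ω)) z := fun ω => by
      simp only [EMV.onSpaceTime, u, max_eq_left hz0]
    rw [EMV.integral_law ?_ hg]
    · simp only [hUz]
    · simp only [← hUz]
      exact ((hu _ (hε (s n)) _ (hh _ _)).measurable_onSpaceTime _).comp measurable_prodMk_left
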